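/- Let $n\in\mathbb N$ and let $U\subset\mathbb R^n$ be a bounded open set with Lipschitz boundary and outer unit normal field $\mathbf n$. Let $a:\mathbb R^n\times\mathbb R^n\to\mathbb R^n$, $(x,p)\mapsto a(x,p)$, and suppose that there are constants $C_L\ge 0$, $C_M>0$, $C_Q\ge 0$ such that for all $x,y,p,q\in\mathbb R^n$ \[ |a(x,p)-a(x,q)|\le C_L|p-q|,\qquad (a(x,p)-a(x,q))\cdot(p-q)\ge C_M|p-q|^2,\qquad |a(x,p)-a(y,p)|\le C_Q(|p|+1)|x-y| . \] For $f\in L^2(U)$, a function $u\in H^1(U)$ is called a weak solution of \[ -\nabla\cdot a(\cdot,\nabla u)=f \ \text{ in } U,\qquad a(\cdot,\nabla u)\cdot\mathbf n=0\ \text{ on }\partial U, \] if $\int_U a(x,\nabla u)\cdot\nabla v\,dx=\int_U f v\,dx$ for all $v\in H^1(U)$. Then, for every $f\in L^2(U)$, every weak solution $u$ belongs to $H^2_{\mathrm{loc}}(U)$. Moreover, for every open set $V$ whose closure is a compact subset of $U$, there is a constant $C\ge 0$ depending only on $U$, $V$ and $a$ (in particular, not on $f$ or $u$) such that, for every $f\in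 L^2(U)$ and every weak solution $u$, \[ \|u\|_{H^2(V)}\le C\big(\|f\|_{L^2(U)}+\|u\|_{L^2(U)}+1\big), \] where $\|u\|_{H^2(V)}^2=\|u\|_{L^2(V)}^2+\|\nabla u\|_{L^2(V)}^2+\|D^2u\|_{L^2(V)}^2$. -/

import Mathlib

open MeasureTheory Set
open scoped NNReal ContDiff RealInnerProductSpace

noncomputable section

namespace QuasilinearReg

/-- The Euclidean space of dimension `n`. -/
abbrev E (n : ℕ) : Type := EuclideanSpace ℝ (Fin n)

/-- The set `U` has a Lipschitz boundary: near each boundary point, `U` is, for some unit vector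
`ν`, the strict epigraph in direction `ν` of a Lipschitz function on the hyperplane `ν^⊥`. -/
def HasLipschitzBoundary {n : ℕ} (U : Set (E n)) : Prop :=
  ∀ x₀ ∈ frontier U, ∃ r : ℝ, 0 < r ∧ ∃ ν : E n, ‖ν‖ = 1 ∧
    ∃ (K : ℝ≥0) (γ : (Submodule.span ℝ {ν})ᗮ → ℝ), LipschitzWith K γ ∧
      U ∩ Metric.ball x₀ r =
        {x ∈ Metric.ball x₀ r | γ ((Submodule.span ℝ {ν})ᗮ.orthogonalProjectionOnto x) < ⟪x, ν⟫}

/-- `V` is an open set which is compactly contained in `U`. -/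
def OpenCompactlyContained {n : ℕ} (V U : Set (E n)) : Prop :=
  IsOpen V ∧ IsCompact (closure V) ∧ closure V ⊆ U

/-- `g` is a weak `i`-th partial derivative of `u` on the open set `U`; the test functions are the
smooth functions with compact support in `U`. -/
def IsWeakPartial {n : ℕ} (U : Set (E n)) (i : Fin n) (u g : E n → ℝ) : Prop :=
  LocallyIntegrableOn u U ∧ LocallyIntegrableOn g U ∧
    ∀ φ : E n → ℝ, ContDiff ℝ ∞ φ → HasCompactSupport φ → tsupport φ ⊆ U →
      ∫ x in U, u x * fderiv ℝ φ x (EuclideanSpace.single i 1) = -∫ x in U, g x * φ x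

open Classical in
/-- The weak `i`-th partial derivative of `u` on `U` (a representative of it, unique up to equality
almost everywhere on `U`); it is zero if there is none. -/
def weakPartial {n : ℕ} (U : Set (E n)) (i : Fin n) (u : E n → ℝ) : E n → ℝ :=
  if h : ∃ g, IsWeakPartial U i u g then h.choose else 0

/-- The weak gradient of `u` on `U`. -/
def weakGrad {n : ℕ} (U : Set (E n)) (u : E n → ℝ) (x : E n) : E n :=
  WithLp.toLp 2 fun i => weakPartial U i u x

/-- `u ∈ L²(U)`. -/
def MemL2 {n : ℕ} (U : Set (E n)) (u : E n → ℝ) : Prop :=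
  MemLp u 2 (volume.restrict U)

/-- `u ∈ H¹(U)`: `u` and its weak first order partial derivatives are in `L²(U)`. -/
def MemH1 {n : ℕ} (U : Set (E n)) (u : E n → ℝ) : Prop :=
  MemL2 U u ∧ ∀ i, ∃ g, IsWeakPartial U i u g ∧ MemL2 U g

/-- `u ∈ H²(U)`: `u` and its weak first order partial derivatives are in `H¹(U)`. -/
def MemH2 {n : ℕ} (U : Set (E n)) (u : E n → ℝ) : Prop :=
  MemH1 U u ∧ ∀ i, MemH1 U (weakPartial U i u)

/-- `u ∈ H²_loc(U)`. -/
def MemH2Loc {n : ℕ} (U : Set (E n)) (u : E n → ℝ) : Prop :=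
  ∀ V : Set (E n), OpenCompactlyContained V U → MemH2 V u

/-- The norm of `L²(U)`. -/
def l2Norm {n : ℕ} (U : Set (E n)) (u : E n → ℝ) : ℝ :=
  (eLpNorm u 2 (volume.restrict U)).toReal

/-- The norm of `H²(U)`. -/
def h2Norm {n : ℕ} (U : Set (E n)) (u : E n → ℝ) : ℝ :=
  Real.sqrt (l2Norm U u ^ 2 + ∑ i, l2Norm U (weakPartial U i u) ^ 2 +
    ∑ i, ∑ j, l2Norm U (weakPartial U j (weakPartial U i u)) ^ 2)

/-- `u` is a weak solution of `-∇ · a(·, ∇u) = f` in `U`, `a(·, ∇u) · 𝐧 = 0` on the boundary.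
The boundary condition is encoded by testing with all functions in `H¹(U)`. -/
def IsWeakSolution {n : ℕ} (U : Set (E n)) (a : E n → E n → E n) (f u : E n → ℝ) : Prop :=
  MemH1 U u ∧ ∀ v : E n → ℝ, MemH1 U v →
    ∫ x in U, ⟪a x (weakGrad U u x), weakGrad U v x⟫ = ∫ x in U, f x * v x

end QuasilinearReg

end

/-!
The proof is Nirenberg's method of difference quotients, carried out with undivided differences.

Since the Neumann condition admits every test function in `H¹(U)`, testing the equation with `u`
itself bounds the gradient on all of `U` (`StructureConditions.exists_integral_grad_sq_le`). In the
interior, cutoff functions `ζ` and `η` are chosen so that `ζ` is one on `V` and `η` is one near all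
small translates of the support of `ζ`; then `w = η u` is an `H¹` function on the whole space. The
equation is tested with `ψ(· - h) - ψ`, where `ψ = ζ² (w(· + h) - w)`. Summation by parts moves the
difference onto the flux `a(x, ∇u)`, strong monotonicity bounds `ζ² |∇w(· + h) - ∇w|²` from below,
and all other terms are absorbed or of order `|h|²`
(`StructureConditions.integral_cutoff_difference_sq_le`).

Two facts relate differences and weak derivatives: the `L²` norm of `w(· + h) - w` is at most that
of `∇w · h` (`HasWeakGradOn.eLpNorm_translate_sub_le`), and conversely a function whose differences
are of first order in `L²(V)` has a weak derivative in `L²(V)`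
(`exists_weak_deriv_of_translate_le`). Both are proved by duality: the function
`t ↦ ∫ w(x) φ(x - t h) dx` is differentiable for every test function `φ`
(`hasDerivAt_integral_translate`), and a functional on test functions which is bounded in the `L²`
norm is represented by an `L²` function, by the Hahn-Banach theorem and the Riesz representation
theorem (`exists_memLp_integral_eq`).
-/

open MeasureTheory Set
open scoped NNReal ContDiff RealInnerProductSpace

namespace QuasilinearReg

/-! ### Integrals of squares -/

section Squares

variable {α F : Type*} [MeasurableSpace α] {μ : Measure α} [NormedAddCommGroup F]

theorem integrable_norm_sq {f : α → F} (hf : MemLp f 2 μ) : Integrable (fun x => ‖f x‖ ^ 2) μ :=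
  (memLp_two_iff_integrable_sq_norm hf.1).1 hf

theorem integral_norm_sq_eq {f : α → F} (hf : MemLp f 2 μ) :
    ∫ x, ‖f x‖ ^ 2 ∂μ = (eLpNorm f 2 μ).toReal ^ 2 := by
  have h0 : 0 ≤ ∫ x, ‖f x‖ ^ 2 ∂μ := integral_nonneg fun _ => by positivity
  rw [hf.eLpNorm_eq_integral_rpow_norm two_ne_zero ENNReal.ofNat_ne_top, ENNReal.toReal_ofReal]
  · simp only [ENNReal.toReal_ofNat, Real.rpow_ofNat]
    rw [← Real.rpow_natCast, ← Real.rpow_mul h0]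
    norm_num
  · positivity

theorem integral_sq_eq {f : α → ℝ} (hf : MemLp f 2 μ) :
    ∫ x, f x ^ 2 ∂μ = (eLpNorm f 2 μ).toReal ^ 2 := by
  simpa using integral_norm_sq_eq hf

theorem abs_integral_mul_le {f g : α → ℝ} (hf : MemLp f 2 μ) (hg : MemLp g 2 μ) :
    |∫ x, f x * g x ∂μ| ≤ (eLpNorm f 2 μ).toReal * (eLpNorm g 2 μ).toReal := by
  have h := abs_real_inner_le_norm (hf.toLp f) (hg.toLp g)
  rw [Lp.norm_toLp, Lp.norm_toLp, L2.inner_def] at h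
  convert h using 2
  apply integral_congr_ae
  filter_upwards [hf.coeFn_toLp, hg.coeFn_toLp] with x h1 h2
  rw [h1, h2]
  simp [mul_comm]

theorem integrable_inner_of_memLp [InnerProductSpace ℝ F] {f g : α → F} (hf : MemLp f 2 μ)
    (hg : MemLp g 2 μ) : Integrable (fun x => ⟪f x, g x⟫) μ := by
  refine (L2.integrable_inner (𝕜 := ℝ) (hf.toLp f) (hg.toLp g)).congr ?_
  filter_upwards [hf.coeFn_toLp, hg.coeFn_toLp] with x h1 h2
  rw [h1, h2]

end Squares

/-! ### Representation of bounded functionals on test functions -/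

/-- A linear functional on a vector space mapped into a Hilbert space which is bounded by the
Hilbert norm is the inner product with a vector; the image need not be dense. -/
theorem exists_inner_eq_of_abs_le {S H : Type*} [AddCommGroup S] [Module ℝ S]
    [NormedAddCommGroup H] [InnerProductSpace ℝ H] [CompleteSpace H]
    (ι : S →ₗ[ℝ] H) (T : S →ₗ[ℝ] ℝ) {M : ℝ} (hM : 0 ≤ M) (hT : ∀ s, |T s| ≤ M * ‖ι s‖) :
    ∃ G : H, ‖G‖ ≤ M ∧ ∀ s, T s = ⟪G, ι s⟫ := by
  have hker : LinearMap.ker ι ≤ LinearMap.ker T := by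
    intro s hs
    rw [LinearMap.mem_ker] at hs ⊢
    have := hT s
    rw [hs, norm_zero, mul_zero] at this
    exact abs_nonpos_iff.1 this
  let T' : LinearMap.range ι →ₗ[ℝ] ℝ :=
    ((LinearMap.ker ι).liftQ T hker).comp ι.quotKerEquivRange.symm.toLinearMap
  have hT' : ∀ s, T' ⟨ι s, LinearMap.mem_range_self ι s⟩ = T s := by
    intro s
    have : ι.quotKerEquivRange.symm ⟨ι s, LinearMap.mem_range_self ι s⟩
        = (LinearMap.ker ι).mkQ s := by
      rw [LinearEquiv.symm_apply_eq]
      rfl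
    simp only [T', LinearMap.comp_apply, LinearEquiv.coe_coe, this]
    simp
  let T'' : StrongDual ℝ (LinearMap.range ι) := T'.mkContinuous M (by
    rintro ⟨_, s, rfl⟩
    rw [hT', Real.norm_eq_abs]
    exact hT s)
  obtain ⟨g, hg, hgn⟩ := exists_extension_norm_eq (LinearMap.range ι) T''
  refine ⟨(InnerProductSpace.toDual ℝ H).symm g, ?_, fun s => ?_⟩
  · rw [LinearIsometryEquiv.norm_map, hgn]
    exact LinearMap.mkContinuous_norm_le _ hM _
  · rw [InnerProductSpace.toDual_symm_apply]
    have := hg ⟨ι s, LinearMap.mem_range_self ι s⟩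
    rw [← hT' s]
    exact this.symm

variable {n : ℕ}

/-- The test functions on `U`: the smooth functions with compact support in `U`. -/
structure IsTest (U : Set (E n)) (φ : E n → ℝ) : Prop where
  contDiff : ContDiff ℝ ∞ φ
  hasCompactSupport : HasCompactSupport φ
  tsupport_subset : tsupport φ ⊆ U

namespace IsTest

variable {U : Set (E n)} {φ ψ : E n → ℝ}

theorem continuous (h : IsTest U φ) : Continuous φ := h.contDiff.continuous

theorem differentiable (h : IsTest U φ) : Differentiable ℝ φ :=
  h.contDiff.differentiable (by simp)

theorem continuous_fderiv (h : IsTest U φ) : Continuous (fderiv ℝ φ) :=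
  h.contDiff.continuous_fderiv (by simp)

theorem continuous_fderiv_apply (h : IsTest U φ) (e : E n) :
    Continuous fun x => fderiv ℝ φ x e := h.continuous_fderiv.clm_apply continuous_const

theorem memLp (h : IsTest U φ) (μ : Measure (E n)) [IsFiniteMeasureOnCompacts μ] :
    MemLp φ 2 μ := h.continuous.memLp_of_hasCompactSupport h.hasCompactSupport

theorem memLp_fderiv (h : IsTest U φ) (μ : Measure (E n)) [IsFiniteMeasureOnCompacts μ] (e : E n) :
    MemLp (fun x => fderiv ℝ φ x e) 2 μ :=
  (h.continuous_fderiv_apply e).memLp_of_hasCompactSupport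
    (h.hasCompactSupport.fderiv_apply ℝ e)

theorem mono {V : Set (E n)} (h : IsTest V φ) (hVU : V ⊆ U) : IsTest U φ :=
  ⟨h.1, h.2, h.3.trans hVU⟩

theorem eq_zero (h : IsTest U φ) {x : E n} (hx : x ∉ U) : φ x = 0 :=
  image_eq_zero_of_notMem_tsupport fun h' => hx (h.3 h')

theorem fderiv_eq_zero (h : IsTest U φ) {x : E n} (hx : x ∉ U) : fderiv ℝ φ x = 0 := by
  by_contra hne
  exact hx (h.3 (support_fderiv_subset ℝ hne))

theorem add (h : IsTest U φ) (h' : IsTest U ψ) : IsTest U (φ + ψ) :=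
  ⟨h.1.add h'.1, h.2.add h'.2,
    (tsupport_add φ ψ).trans (union_subset h.3 h'.3)⟩

theorem const_smul (h : IsTest U φ) (c : ℝ) : IsTest U (c • φ) :=
  ⟨h.1.const_smul c, h.2.smul_left (f := fun _ => c),
    (closure_mono (Function.support_const_smul_subset c φ)).trans h.3⟩

/-- The product of a test function with a smooth function is a test function. -/
theorem mul_left (h : IsTest U φ) (hψ : ContDiff ℝ ∞ ψ) : IsTest U (fun x => ψ x * φ x) :=
  ⟨hψ.mul h.1, h.2.mul_left, (tsupport_mul_subset_right (f := ψ) (g := φ)).trans h.3⟩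

theorem comp_sub (h : IsTest U φ) (v : E n) : IsTest univ fun x => φ (x - v) :=
  ⟨h.1.comp (contDiff_id.sub contDiff_const),
    h.2.comp_homeomorph (Homeomorph.subRight v), subset_univ _⟩

theorem exists_bound (h : IsTest U φ) : ∃ C, 0 ≤ C ∧ ∀ x, |φ x| ≤ C := by
  obtain ⟨C, hC⟩ := h.hasCompactSupport.exists_bound_of_continuous h.continuous
  exact ⟨C, (norm_nonneg _).trans (hC 0), hC⟩

theorem exists_bound_fderiv (h : IsTest U φ) : ∃ C, 0 ≤ C ∧ ∀ x, ‖fderiv ℝ φ x‖ ≤ C := by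
  obtain ⟨C, hC⟩ := (h.hasCompactSupport.fderiv ℝ).exists_bound_of_continuous h.continuous_fderiv
  exact ⟨C, (norm_nonneg _).trans (hC 0), hC⟩

end IsTest

/-- The vector space of test functions on `U`. -/
def testSpace (U : Set (E n)) : Submodule ℝ (E n → ℝ) where
  carrier := {φ | IsTest U φ}
  add_mem' h h' := h.add h'
  zero_mem' := ⟨contDiff_const, HasCompactSupport.zero, by simp [tsupport]⟩
  smul_mem' c _ h := h.const_smul c

/-- The embedding of the test functions into `L²`. -/
noncomputable def testToLp (U : Set (E n)) (μ : Measure (E n)) [IsFiniteMeasureOnCompacts μ] :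
    testSpace U →ₗ[ℝ] Lp ℝ 2 μ where
  toFun φ := (IsTest.memLp φ.2 μ).toLp φ.1
  map_add' _ _ := rfl
  map_smul' _ _ := rfl

/-- A linear functional on the test functions bounded by `M` times the `L²` norm is integration
against an `L²` function of norm at most `M`. -/
theorem exists_memLp_integral_eq (U : Set (E n)) (μ : Measure (E n)) [IsFiniteMeasureOnCompacts μ]
    (T : testSpace U →ₗ[ℝ] ℝ) {M : ℝ} (hM : 0 ≤ M)
    (hT : ∀ φ, |T φ| ≤ M * (eLpNorm φ.1 2 μ).toReal) :
    ∃ H : E n → ℝ, MemLp H 2 μ ∧ (eLpNorm H 2 μ).toReal ≤ M ∧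
      ∀ φ, T φ = ∫ x, H x * φ.1 x ∂μ := by
  obtain ⟨G, hG, hTG⟩ := exists_inner_eq_of_abs_le (testToLp U μ) T hM (fun φ => by
    have : ‖testToLp U μ φ‖ = (eLpNorm φ.1 2 μ).toReal :=
      Lp.norm_toLp φ.1 (IsTest.memLp φ.2 μ)
    rw [this]
    exact hT φ)
  refine ⟨G, Lp.memLp G, by simpa [Lp.norm_def] using hG, fun φ => ?_⟩
  rw [hTG, L2.inner_def]
  apply integral_congr_ae
  filter_upwards [(IsTest.memLp φ.2 μ).coeFn_toLp] with x hx
  have : testToLp U μ φ x = φ.1 x := hx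
  rw [this]
  simp [mul_comm]

/-- A function in `L²(ℝⁿ)` whose pairings with the test functions are bounded by `M` times their
norm has norm at most `M`. -/
theorem eLpNorm_le_of_forall_isTest {w : E n → ℝ} (hw : MemLp w 2 volume) {M : ℝ} (hM : 0 ≤ M)
    (h : ∀ φ, IsTest univ φ → |∫ x, w x * φ x| ≤ M * (eLpNorm φ 2 volume).toReal) :
    (eLpNorm w 2 volume).toReal ≤ M := by
  let T : testSpace (univ : Set (E n)) →ₗ[ℝ] ℝ :=
    { toFun := fun φ => ∫ x, w x * φ.1 x
      map_add' := fun φ ψ => by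
        simp only [Submodule.coe_add, Pi.add_apply, mul_add]
        exact integral_add (hw.integrable_mul (IsTest.memLp φ.2 _))
          (hw.integrable_mul (IsTest.memLp ψ.2 _))
      map_smul' := fun c φ => by
        simp only [Submodule.coe_smul, Pi.smul_apply, smul_eq_mul, RingHom.id_apply]
        rw [← integral_const_mul]
        congr 1
        ext x
        ring }
  obtain ⟨H, hH, hHM, hTH⟩ := exists_memLp_integral_eq univ volume T hM (fun φ => h φ.1 φ.2)
  have : ∀ᵐ x, w x = H x := by
    refine ae_eq_of_integral_contDiff_smul_eq (hw.locallyIntegrable one_le_two)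
      (hH.locallyIntegrable one_le_two) fun g hg hgs => ?_
    have := hTH ⟨g, hg, hgs, subset_univ _⟩
    simpa [T, mul_comm] using this
  rwa [eLpNorm_congr_ae this]

/-! ### Weak gradients -/

/-- `G` is the weak gradient of `w` on `U`, both being square integrable on `U`. The identity
defining the weak derivative is stated for all directions `e` at once. -/
structure HasWeakGradOn (U : Set (E n)) (w : E n → ℝ) (G : E n → E n) : Prop where
  memLp : MemLp w 2 (volume.restrict U)
  memLp_grad : MemLp G 2 (volume.restrict U)
  integral_eq : ∀ (φ : E n → ℝ), IsTest U φ → ∀ e : E n,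
    ∫ x in U, w x * fderiv ℝ φ x e = -∫ x in U, ⟪G x, e⟫ * φ x

namespace HasWeakGradOn

variable {U V : Set (E n)} {w w' : E n → ℝ} {G G' : E n → E n}

theorem sub (h : HasWeakGradOn U w G) (h' : HasWeakGradOn U w' G') :
    HasWeakGradOn U (fun x => w x - w' x) (fun x => G x - G' x) := by
  refine ⟨h.1.sub h'.1, h.2.sub h'.2, fun φ hφ e => ?_⟩
  simp only [sub_mul, inner_sub_left]
  rw [integral_sub, integral_sub, h.3 φ hφ, h'.3 φ hφ]
  · ring
  · exact (h.2.inner_const e).integrable_mul (hφ.memLp _)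
  · exact (h'.2.inner_const e).integrable_mul (hφ.memLp _)
  · exact h.1.integrable_mul (hφ.memLp_fderiv _ e)
  · exact h'.1.integrable_mul (hφ.memLp_fderiv _ e)

theorem mono (h : HasWeakGradOn U w G) (hVU : V ⊆ U) : HasWeakGradOn V w G := by
  refine ⟨h.1.mono_measure (Measure.restrict_mono hVU le_rfl),
    h.2.mono_measure (Measure.restrict_mono hVU le_rfl), fun φ hφ e => ?_⟩
  have h1 := h.3 φ (hφ.mono hVU) e
  have restr : ∀ W : Set (E n), V ⊆ W →
      ∫ x in W, w x * fderiv ℝ φ x e = ∫ x, w x * fderiv ℝ φ x e ∧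
      ∫ x in W, ⟪G x, e⟫ * φ x = ∫ x, ⟪G x, e⟫ * φ x := fun W hW =>
    ⟨setIntegral_eq_integral_of_forall_compl_eq_zero fun x hx => by
      simp [(hφ.mono hW).fderiv_eq_zero hx],
      setIntegral_eq_integral_of_forall_compl_eq_zero fun x hx => by
      simp [(hφ.mono hW).eq_zero hx]⟩
  rw [(restr U hVU).1, (restr U hVU).2] at h1
  rw [(restr V subset_rfl).1, (restr V subset_rfl).2, h1]

theorem memLp_univ (h : HasWeakGradOn univ w G) : MemLp w 2 volume := by simpa using h.1

theorem memLp_grad_univ (h : HasWeakGradOn univ w G) : MemLp G 2 volume := by simpa using h.2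

theorem integral_eq_univ (h : HasWeakGradOn univ w G) {φ : E n → ℝ} (hφ : IsTest univ φ) (e : E n) :
    ∫ x, w x * fderiv ℝ φ x e = -∫ x, ⟪G x, e⟫ * φ x := by
  simpa using h.3 φ hφ e

theorem comp_add (h : HasWeakGradOn univ w G) (v : E n) :
    HasWeakGradOn univ (fun x => w (x + v)) (fun x => G (x + v)) := by
  refine ⟨?_, ?_, fun φ hφ e => ?_⟩
  · rw [Measure.restrict_univ]
    exact h.memLp_univ.comp_measurePreserving (measurePreserving_add_right volume v)
  · rw [Measure.restrict_univ]
    exact h.memLp_grad_univ.comp_measurePreserving (measurePreserving_add_right volume v)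
  · have h1 := h.integral_eq_univ (hφ.comp_sub v) e
    rw [← integral_add_right_eq_self _ v,
      ← integral_add_right_eq_self (fun x => ⟪G x, e⟫ * φ (x - v)) v] at h1
    simpa [fderiv_comp_sub] using h1

/-- Multiplication by a cutoff function with support in `U` turns a function with a weak gradient
on `U` into one with a weak gradient on the whole space. -/
theorem cutoff_mul (hU : IsOpen U) (h : HasWeakGradOn U w G) {ζ : E n → ℝ} (hζ : IsTest U ζ) :
    HasWeakGradOn univ (fun x => ζ x * w x) (fun x => ζ x • G x + w x • gradient ζ x) := by
  obtain ⟨C, -, hC⟩ := hζ.exists_bound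
  obtain ⟨C', -, hC'⟩ := hζ.exists_bound_fderiv
  have hgc : Continuous (gradient ζ) :=
    (InnerProductSpace.toDual ℝ (E n)).symm.continuous.comp hζ.continuous_fderiv
  have hg0 : ∀ x ∉ U, gradient ζ x = 0 := fun x hx => by
    simp [gradient, hζ.fderiv_eq_zero hx]
  refine ⟨?_, ?_, fun φ hφ e => ?_⟩
  · rw [Measure.restrict_univ]
    have h1 : MemLp (fun x => ζ x * w x) 2 (volume.restrict U) :=
      h.1.of_le_mul (c := C) (hζ.continuous.aestronglyMeasurable.mul h.1.1)
        (.of_forall fun x => by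
          rw [norm_mul]
          exact mul_le_mul_of_nonneg_right (hC x) (norm_nonneg _))
    rw [← memLp_indicator_iff_restrict hU.measurableSet] at h1
    rwa [indicator_eq_self.2] at h1
    intro x hx
    by_contra hxU
    exact hx (by simp [hζ.eq_zero hxU])
  · rw [Measure.restrict_univ]
    have h1 : MemLp (fun x => ζ x • G x) 2 (volume.restrict U) :=
      h.2.of_le_mul (c := C) (hζ.continuous.aestronglyMeasurable.smul h.2.1)
        (.of_forall fun x => by
          rw [norm_smul]
          exact mul_le_mul_of_nonneg_right (hC x) (norm_nonneg _))
    have h2 : MemLp (fun x => w x • gradient ζ x) 2 (volume.restrict U) :=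
      h.1.of_le_mul (c := C') (h.1.1.smul hgc.aestronglyMeasurable)
        (.of_forall fun x => by
          rw [norm_smul, mul_comm]
          refine mul_le_mul_of_nonneg_right ?_ (norm_nonneg _)
          simpa [gradient] using hC' x)
    have h3 := h1.add h2
    rw [← memLp_indicator_iff_restrict hU.measurableSet] at h3
    rwa [indicator_eq_self.2] at h3
    intro x hx
    by_contra hxU
    exact hx (by simp [hζ.eq_zero hxU, hg0 x hxU])
  · have hprod : IsTest U fun x => φ x * ζ x := hζ.mul_left hφ.1
    have key := h.3 _ hprod e
    have hfd : ∀ x, fderiv ℝ (fun x => φ x * ζ x) x e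
        = φ x * fderiv ℝ ζ x e + ζ x * fderiv ℝ φ x e := fun x => by
      rw [fderiv_fun_mul hφ.differentiable.differentiableAt hζ.differentiable.differentiableAt]
      simp
    have hgr : ∀ x, ⟪gradient ζ x, e⟫ = fderiv ℝ ζ x e := fun x => by
      simp [gradient, InnerProductSpace.toDual_symm_apply]
    simp only [Measure.restrict_univ]
    rw [← setIntegral_eq_integral_of_forall_compl_eq_zero (s := U),
      ← setIntegral_eq_integral_of_forall_compl_eq_zero (s := U)
        (f := fun x => ⟪ζ x • G x + w x • gradient ζ x, e⟫ * φ x)]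
    · have i1 : Integrable (fun x => w x * (φ x * fderiv ℝ ζ x e)) (volume.restrict U) := by
        exact h.1.integrable_mul ((hφ.continuous.mul
          (hζ.continuous_fderiv_apply e)).memLp_of_hasCompactSupport (p := 2) hφ.2.mul_right)
      have i2 : Integrable (fun x => w x * (ζ x * fderiv ℝ φ x e)) (volume.restrict U) := by
        exact h.1.integrable_mul ((hζ.continuous.mul
          (hφ.continuous_fderiv_apply e)).memLp_of_hasCompactSupport (p := 2) hζ.2.mul_right)
      have i3 : Integrable (fun x => ⟪G x, e⟫ * (φ x * ζ x)) (volume.restrict U) :=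
        (h.2.inner_const e).integrable_mul (hprod.memLp _)
      simp only [hfd, mul_add] at key
      rw [integral_add i1 i2] at key
      have e1 : ∫ x in U, ⟪ζ x • G x + w x • gradient ζ x, e⟫ * φ x
          = (∫ x in U, ⟪G x, e⟫ * (φ x * ζ x)) + ∫ x in U, w x * (φ x * fderiv ℝ ζ x e) := by
        rw [← integral_add i3 i1]
        congr 1
        ext x
        simp only [inner_add_left, real_inner_smul_left, hgr]
        ring
      rw [e1]
      have e2 : ∫ x in U, ζ x * w x * fderiv ℝ φ x e = ∫ x in U, w x * (ζ x * fderiv ℝ φ x e) := by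
        congr 1
        ext x
        ring
      rw [e2]
      linarith
    · intro x hx
      simp [hζ.eq_zero hx, hg0 x hx]
    · intro x hx
      simp [hζ.eq_zero hx]

end HasWeakGradOn

/-! ### Translations and difference quotients -/

theorem hasDerivAt_integral_translate {w : E n → ℝ} (hw : LocallyIntegrable w) {φ : E n → ℝ}
    (hφ : IsTest univ φ) (h : E n) (t : ℝ) :
    HasDerivAt (fun t : ℝ => ∫ x, w x * φ (x - t • h))
      (-∫ x, w x * fderiv ℝ φ (x - t • h) h) t := by
  -- the integral is a convolution with the reflected test function
  have hg : ContDiff ℝ 1 fun z => φ (-z) := (hφ.1.of_le (by simp)).comp contDiff_neg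
  have hgs : HasCompactSupport fun z => φ (-z) := hφ.2.comp_homeomorph (Homeomorph.neg (E n))
  have h1 := hgs.hasFDerivAt_convolution_right (ContinuousLinearMap.mul ℝ ℝ) hw hg (t • h)
  have h2 : HasDerivAt (fun t : ℝ => t • h) h t := by
    simpa using (hasDerivAt_id t).smul_const h
  have h3 := h1.comp_hasDerivAt t h2
  refine (h3.congr_deriv ?_).congr_of_eventuallyEq (.of_forall fun s => ?_)
  · rw [convolution_precompR_apply (ContinuousLinearMap.mul ℝ ℝ) hw (hgs.fderiv ℝ)
      (hg.continuous_fderiv (by simp)), convolution_def, ← integral_neg]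
    congr 1
    ext x
    have : fderiv ℝ (fun z => φ (-z)) (t • h - x) h = - fderiv ℝ φ (x - t • h) h := by
      have h4 : HasFDerivAt φ (fderiv ℝ φ (x - t • h)) (-(t • h - x)) := by
        rw [neg_sub]
        exact hφ.differentiable.differentiableAt.hasFDerivAt
      have h5 : HasFDerivAt (fun z => φ (-z)) _ (t • h - x) :=
        h4.comp (t • h - x) (hasFDerivAt_id (t • h - x)).neg
      rw [h5.fderiv]
      simp
    simp [this]
  · simp [convolution_def]

theorem integral_translate_sub_mul {w φ : E n → ℝ} (hw : MemLp w 2 volume) (hφ : MemLp φ 2 volume)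
    (v : E n) :
    ∫ x, (w (x + v) - w x) * φ x = (∫ x, w x * φ (x - v)) - ∫ x, w x * φ x := by
  have hwv : MemLp (fun x => w (x + v)) 2 volume :=
    hw.comp_measurePreserving (measurePreserving_add_right volume v)
  simp only [sub_mul]
  have := integral_sub (hwv.integrable_mul hφ) (hw.integrable_mul hφ)
  simp only [Pi.mul_apply] at this
  rw [this, ← integral_add_right_eq_self (fun x => w x * φ (x - v)) v]
  simp

theorem eLpNorm_comp_sub (φ : E n → ℝ) (hφ : AEStronglyMeasurable φ volume) (v : E n) :
    eLpNorm (fun x => φ (x - v)) 2 volume = eLpNorm φ 2 volume :=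
  eLpNorm_comp_measurePreserving hφ (measurePreserving_sub_right volume v)

/-- The `L²` norm of a difference of a Sobolev function is at most that of its derivative. The
proof is by duality: the pairing with a test function is a difference of values of a function of one
variable whose derivative is the pairing of the weak derivative with a translated test function. -/
theorem HasWeakGradOn.eLpNorm_translate_sub_le {w : E n → ℝ} {G : E n → E n}
    (hw : HasWeakGradOn univ w G) (h : E n) :
    (eLpNorm (fun x => w (x + h) - w x) 2 volume).toReal
      ≤ (eLpNorm (fun x => ⟪G x, h⟫) 2 volume).toReal := by
  have hwm := hw.memLp_univ
  have hGm := hw.memLp_grad_univ.inner_const (𝕜 := ℝ) h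
  refine eLpNorm_le_of_forall_isTest ((hwm.comp_measurePreserving
    (measurePreserving_add_right volume h)).sub hwm) ENNReal.toReal_nonneg fun φ hφ => ?_
  have heq := integral_translate_sub_mul hwm (hφ.memLp _) h
  change |∫ x, (w (x + h) - w x) * φ x| ≤ _
  rw [heq]
  have := norm_image_sub_le_of_norm_deriv_le_segment_01'
    (f := fun t : ℝ => ∫ x, w x * φ (x - t • h))
    (C := (eLpNorm (fun x => ⟪G x, h⟫) 2 volume).toReal * (eLpNorm φ 2 volume).toReal)
    (fun t _ => (hasDerivAt_integral_translate (hwm.locallyIntegrable one_le_two) hφ h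
      t).hasDerivWithinAt) (fun t _ => by
      have h1 := hw.integral_eq_univ (hφ.comp_sub (t • h)) h
      simp only [fderiv_comp_sub] at h1
      rw [h1, neg_neg, Real.norm_eq_abs, ← eLpNorm_comp_sub φ hφ.continuous.aestronglyMeasurable
        (t • h)]
      exact abs_integral_mul_le hGm ((hφ.comp_sub _).memLp _))
  simpa using this

/-- If the differences of `g` in the direction `e` are of order `t` in `L²(V)`, then `g` has a weak
derivative in the direction `e` on `V`, with norm bounded by the same constant. -/
theorem exists_weak_deriv_of_translate_le {V : Set (E n)} {g : E n → ℝ}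
    (hg : MemLp g 2 volume) (e : E n) {M r : ℝ} (hM : 0 ≤ M) (hr : 0 < r)
    (h : ∀ t : ℝ, |t| < r →
      (eLpNorm (fun x => g (x + t • e) - g x) 2 (volume.restrict V)).toReal ≤ M * |t|) :
    ∃ H : E n → ℝ, MemLp H 2 (volume.restrict V) ∧
      (eLpNorm H 2 (volume.restrict V)).toReal ≤ M ∧
      ∀ φ, IsTest V φ → ∫ x in V, g x * fderiv ℝ φ x e = -∫ x in V, H x * φ x := by
  have hgV : MemLp g 2 (volume.restrict V) := hg.restrict V
  let T : testSpace V →ₗ[ℝ] ℝ :=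
    { toFun := fun φ => -∫ x in V, g x * fderiv ℝ φ.1 x e
      map_add' := fun φ ψ => by
        have hφ : IsTest V φ.1 := φ.2
        have hψ : IsTest V ψ.1 := ψ.2
        have : ∀ x, fderiv ℝ (φ + ψ : testSpace V).1 x e
            = fderiv ℝ φ.1 x e + fderiv ℝ ψ.1 x e := fun x => by
          rw [Submodule.coe_add, fderiv_add hφ.differentiable.differentiableAt
            hψ.differentiable.differentiableAt]
          rfl
        simp only [this, mul_add]
        rw [integral_add, neg_add]
        · exact hgV.integrable_mul (hφ.memLp_fderiv _ e)
        · exact hgV.integrable_mul (hψ.memLp_fderiv _ e)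
      map_smul' := fun c φ => by
        have hφ : IsTest V φ.1 := φ.2
        have : ∀ x, fderiv ℝ (c • φ : testSpace V).1 x e = c * fderiv ℝ φ.1 x e := fun x => by
          rw [Submodule.coe_smul, fderiv_const_smul hφ.differentiable.differentiableAt]
          rfl
        simp only [this, RingHom.id_apply, smul_eq_mul]
        rw [mul_neg, ← integral_const_mul]
        congr 2
        ext x
        ring }
  obtain ⟨H, hH, hHM, hTH⟩ := exists_memLp_integral_eq V (volume.restrict V) T hM (fun φ => by
    have hφ : IsTest V φ.1 := φ.2
    have hφu := hφ.mono (subset_univ V)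
    have hd := hasDerivAt_integral_translate (hg.locallyIntegrable one_le_two) hφu e 0
    have hT : T φ = -∫ x, g x * fderiv ℝ φ.1 (x - (0 : ℝ) • e) e := by
      simp only [zero_smul, sub_zero]
      rw [← setIntegral_eq_integral_of_forall_compl_eq_zero (s := V)]
      · rfl
      · intro x hx
        simp [hφ.fderiv_eq_zero hx]
    rw [hT]
    -- `T φ` is a derivative at zero of a function with difference quotients bounded by `M * ‖φ‖`
    refine hd.le_of_lip' (by positivity) ?_
    filter_upwards [Metric.ball_mem_nhds (0 : ℝ) hr] with t ht
    have ht' : |t| < r := by simpa using ht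
    have h1 := integral_translate_sub_mul hg (hφ.memLp _) (t • e)
    simp only [zero_smul, sub_zero]
    rw [← h1, Real.norm_eq_abs, Real.norm_eq_abs,
      ← setIntegral_eq_integral_of_forall_compl_eq_zero (s := V)
        (fun x hx => by simp [hφ.eq_zero hx])]
    have hgt : MemLp (fun x => g (x + t • e) - g x) 2 (volume.restrict V) :=
      ((hg.comp_measurePreserving (measurePreserving_add_right volume _)).sub hg).restrict V
    refine (abs_integral_mul_le hgt (hφ.memLp _)).trans ?_
    calc _ ≤ M * |t| * _ := mul_le_mul_of_nonneg_right (h t ht') ENNReal.toReal_nonneg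
      _ = _ := by ring)
  refine ⟨H, hH, hHM, fun φ hφ => ?_⟩
  rw [← hTH ⟨φ, hφ⟩]
  simp [T]

/-! ### Uniqueness of weak derivatives -/

section Unique

variable {U V : Set (E n)} {i : Fin n} {u g g' : E n → ℝ}

theorem IsWeakPartial.ae_eq (hU : IsOpen U) (h : IsWeakPartial U i u g)
    (h' : IsWeakPartial U i u g') : g =ᵐ[volume.restrict U] g' := by
  have key := hU.ae_eq_zero_of_integral_contDiff_smul_eq_zero (f := fun x => g x - g' x)
    (μ := volume) (h.2.1.sub h'.2.1) (fun φ hφ hφs hφU => by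
      have hint : ∀ f : E n → ℝ, LocallyIntegrableOn f U →
          Integrable (fun x => f x * φ x) (volume.restrict U) := fun f hf => by
        have h1 : IntegrableOn (fun x => f x * φ x) (tsupport φ) :=
          (hf.integrableOn_compact_subset hφU hφs).mul_continuousOn hφ.continuous.continuousOn hφs
        refine ((integrableOn_iff_integrable_of_support_subset ?_).1 h1).restrict
        exact (Function.support_mul_subset_right f φ).trans (subset_tsupport φ)
      have e1 := h.2.2 φ hφ hφs hφU
      rw [h'.2.2 φ hφ hφs hφU, neg_inj] at e1
      rw [← setIntegral_eq_integral_of_forall_compl_eq_zero (s := U)]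
      · simp only [smul_eq_mul, mul_comm (φ _), sub_mul]
        rw [integral_sub (hint g h.2.1) (hint g' h'.2.1), e1, sub_self]
      · intro x hx
        simp [image_eq_zero_of_notMem_tsupport fun h => hx (hφU h)])
  rw [Filter.EventuallyEq, ae_restrict_iff' hU.measurableSet]
  filter_upwards [key] with x hx hxU
  exact sub_eq_zero.1 (hx hxU)

theorem IsWeakPartial.isWeakPartial_weakPartial (h : IsWeakPartial U i u g) :
    IsWeakPartial U i u (weakPartial U i u) := by
  have hex : ∃ g, IsWeakPartial U i u g := ⟨g, h⟩
  rw [weakPartial, dif_pos hex]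
  exact hex.choose_spec

theorem IsWeakPartial.weakPartial_ae_eq (hU : IsOpen U) (h : IsWeakPartial U i u g) :
    weakPartial U i u =ᵐ[volume.restrict U] g :=
  h.isWeakPartial_weakPartial.ae_eq hU h

theorem isWeakPartial_of_memLp (hu : MemLp u 2 (volume.restrict U))
    (hg : MemLp g 2 (volume.restrict U))
    (h : ∀ φ, IsTest U φ → ∫ x in U, u x * fderiv ℝ φ x (EuclideanSpace.single i 1)
      = -∫ x in U, g x * φ x) : IsWeakPartial U i u g :=
  ⟨locallyIntegrableOn_of_locallyIntegrable_restrict (hu.locallyIntegrable one_le_two),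
    locallyIntegrableOn_of_locallyIntegrable_restrict (hg.locallyIntegrable one_le_two),
    fun φ h1 h2 h3 => h φ ⟨h1, h2, h3⟩⟩

theorem inner_single_one (v : E n) (i : Fin n) :
    ⟪v, EuclideanSpace.single i (1 : ℝ)⟫ = v i := by
  rw [EuclideanSpace.inner_single_right]
  simp

theorem memLp_coord {μ : Measure (E n)} {G : E n → E n} (hG : MemLp G 2 μ) (i : Fin n) :
    MemLp (fun x => G x i) 2 μ := hG.eval_piLp i

end Unique

/-! ### `H¹` functions and their weak gradients -/

namespace HasWeakGradOn

variable {U V : Set (E n)} {u : E n → ℝ} {G : E n → E n}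

theorem isWeakPartial (h : HasWeakGradOn U u G) (i : Fin n) :
    IsWeakPartial U i u fun x => G x i :=
  isWeakPartial_of_memLp h.1 (memLp_coord h.2 i) fun φ hφ => by
    simpa [inner_single_one] using h.3 φ hφ (EuclideanSpace.single i 1)

theorem memH1 (h : HasWeakGradOn U u G) : MemH1 U u :=
  ⟨h.1, fun i => ⟨_, h.isWeakPartial i, memLp_coord h.2 i⟩⟩

theorem weakGrad_ae_eq (hU : IsOpen U) (h : HasWeakGradOn U u G) :
    weakGrad U u =ᵐ[volume.restrict U] G := by
  have : ∀ᵐ x ∂volume.restrict U, ∀ i, weakPartial U i u x = G x i :=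
    ae_all_iff.2 fun i => (h.isWeakPartial i).weakPartial_ae_eq hU
  filter_upwards [this] with x hx
  ext i
  exact hx i

end HasWeakGradOn

/-- The chosen weak partial derivatives of an `H¹` function form a weak gradient. -/
theorem MemH1.hasWeakGradOn {U : Set (E n)} (hU : IsOpen U) {u : E n → ℝ} (h : MemH1 U u) :
    HasWeakGradOn U u (weakGrad U u) := by
  have hp : ∀ i, IsWeakPartial U i u (weakPartial U i u) := fun i => by
    obtain ⟨g, hg, -⟩ := h.2 i
    exact hg.isWeakPartial_weakPartial
  have hG : MemLp (weakGrad U u) 2 (volume.restrict U) := by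
    refine MemLp.of_eval_piLp fun i => ?_
    obtain ⟨g, hg, hg2⟩ := h.2 i
    exact hg2.ae_eq (hg.weakPartial_ae_eq hU).symm
  refine ⟨h.1, hG, fun φ hφ e => ?_⟩
  have h1 : ∀ x, fderiv ℝ φ x e = ∑ i, e i * fderiv ℝ φ x (EuclideanSpace.single i 1) := by
    intro x
    conv_lhs => rw [← (EuclideanSpace.basisFun (Fin n) ℝ).sum_repr e]
    simp
  have h2 : ∀ x, ⟪weakGrad U u x, e⟫ = ∑ i, e i * weakPartial U i u x := fun x => by
    simp [PiLp.inner_apply, weakGrad, mul_comm]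
  have e1 : ∫ x in U, u x * fderiv ℝ φ x e
      = ∑ i, e i * ∫ x in U, u x * fderiv ℝ φ x (EuclideanSpace.single i 1) := by
    simp only [← integral_const_mul]
    rw [← integral_finsetSum]
    · congr 1
      ext x
      rw [h1, Finset.mul_sum]
      exact Finset.sum_congr rfl fun i _ => by ring
    · exact fun i _ => (h.1.integrable_mul (hφ.memLp_fderiv _ _)).const_mul _
  have e2 : ∫ x in U, ⟪weakGrad U u x, e⟫ * φ x
      = ∑ i, e i * ∫ x in U, weakPartial U i u x * φ x := by
    simp only [← integral_const_mul]
    rw [← integral_finsetSum]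
    · congr 1
      ext x
      rw [h2, Finset.sum_mul]
      exact Finset.sum_congr rfl fun i _ => by ring
    · exact fun i _ => ((memLp_coord hG i).integrable_mul (hφ.memLp _)).const_mul _
  rw [e1, e2, ← Finset.sum_neg_distrib]
  refine Finset.sum_congr rfl fun i _ => ?_
  rw [(hp i).2.2 φ hφ.1 hφ.2 hφ.3, mul_neg]

/-- The weak formulation for a test function with any representative `Φ` of its gradient. -/
theorem IsWeakSolution.integral_inner_eq {U : Set (E n)} (hU : IsOpen U)
    {a : E n → E n → E n} {f u v : E n → ℝ} {Φ : E n → E n} (h : IsWeakSolution U a f u)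
    (hv : HasWeakGradOn U v Φ) :
    ∫ x in U, ⟪a x (weakGrad U u x), Φ x⟫ = ∫ x in U, f x * v x := by
  rw [← h.2 v hv.memH1]
  apply integral_congr_ae
  filter_upwards [hv.weakGrad_ae_eq hU] with x hx
  rw [hx]

/-! ### The structure conditions and the global gradient bound -/

/-- The vector field `a` is Lipschitz and strongly monotone in its second argument and Lipschitz in
its first, with a constant of linear growth in the second. -/
structure StructureConditions (a : E n → E n → E n) (CL CM CQ : ℝ) : Prop where
  CL_nonneg : 0 ≤ CL
  CM_pos : 0 < CM
  CQ_nonneg : 0 ≤ CQ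
  lip : ∀ x p q, ‖a x p - a x q‖ ≤ CL * ‖p - q‖
  mono : ∀ x p q, CM * ‖p - q‖ ^ 2 ≤ ⟪a x p - a x q, p - q⟫
  qlip : ∀ x y p, ‖a x p - a y p‖ ≤ CQ * (‖p‖ + 1) * ‖x - y‖

namespace StructureConditions

variable {a : E n → E n → E n} {CL CM CQ : ℝ}

theorem continuous (ha : StructureConditions a CL CM CQ) :
    Continuous fun z : E n × E n => a z.1 z.2 := by
  refine continuous_prod_of_continuous_lipschitzWith' _ ⟨CL, ha.CL_nonneg⟩ (fun x => ?_)
    fun p => ?_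
  · exact LipschitzWith.of_dist_le_mul fun p q => by
      rw [dist_eq_norm, dist_eq_norm]
      exact ha.lip x p q
  · have : LipschitzWith ⟨CQ * (‖p‖ + 1), mul_nonneg ha.CQ_nonneg (by positivity)⟩
        fun x => a x p := LipschitzWith.of_dist_le_mul fun x y => by
      rw [dist_eq_norm, dist_eq_norm]
      exact ha.qlip x y p
    exact this.continuous

theorem exists_bound_zero (ha : StructureConditions a CL CM CQ) {U : Set (E n)}
    (hU : Bornology.IsBounded U) : ∃ C, 0 ≤ C ∧ ∀ x ∈ U, ‖a x 0‖ ≤ C := by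
  have hc : Continuous fun x => a x 0 := ha.continuous.comp (continuous_id.prodMk continuous_const)
  obtain ⟨C, hC⟩ := hU.isCompact_closure.exists_bound_of_continuousOn hc.continuousOn
  exact ⟨|C|, abs_nonneg _, fun x hx => (hC x (subset_closure hx)).trans (le_abs_self C)⟩

theorem memLp_comp (ha : StructureConditions a CL CM CQ) {U : Set (E n)} (hUo : IsOpen U)
    (hU : Bornology.IsBounded U) {G : E n → E n} (hG : MemLp G 2 (volume.restrict U)) :
    MemLp (fun x => a x (G x)) 2 (volume.restrict U) := by
  have : IsFiniteMeasure (volume.restrict U) :=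
    isFiniteMeasure_restrict.2 hU.measure_lt_top.ne
  obtain ⟨C, -, hC⟩ := ha.exists_bound_zero hU
  have hc0 : Continuous fun x => a x 0 := ha.continuous.comp (continuous_id.prodMk continuous_const)
  have h0 : MemLp (fun x => a x 0) 2 (volume.restrict U) :=
    MemLp.of_bound hc0.aestronglyMeasurable C
      ((ae_restrict_iff' hUo.measurableSet).2 (.of_forall hC))
  have hm : AEStronglyMeasurable (fun x => a x (G x)) (volume.restrict U) :=
    ha.continuous.comp_aestronglyMeasurable (aestronglyMeasurable_id.prodMk hG.1)
  have h1 : MemLp (fun x => a x (G x) - a x 0) 2 (volume.restrict U) :=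
    hG.of_le_mul (c := CL) (hm.sub h0.1) (.of_forall fun x => by
      simpa using ha.lip x (G x) 0)
  exact (h1.add h0).ae_eq (.of_forall fun x => sub_add_cancel _ _)

/-- Testing the equation with the solution itself bounds the gradient on all of `U`; this is
admissible since the Neumann condition allows every test function in `H¹(U)`. -/
theorem exists_integral_grad_sq_le (ha : StructureConditions a CL CM CQ) {U : Set (E n)}
    (hUo : IsOpen U) (hU : Bornology.IsBounded U) :
    ∃ C, 0 ≤ C ∧ ∀ f u, MemL2 U f → IsWeakSolution U a f u →
      ∫ x in U, ‖weakGrad U u x‖ ^ 2 ≤ C * ((∫ x in U, f x ^ 2) + (∫ x in U, u x ^ 2) + 1) := by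
  have : IsFiniteMeasure (volume.restrict U) :=
    isFiniteMeasure_restrict.2 hU.measure_lt_top.ne
  obtain ⟨C0, hC0, hC⟩ := ha.exists_bound_zero hU
  have hCM := ha.CM_pos
  set m : ℝ := volume.real U
  have hm : 0 ≤ m := measureReal_nonneg
  refine ⟨(1 + C0 ^ 2 * m / CM) / CM, by positivity, fun f u hf hu => ?_⟩
  have hG := hu.1.hasWeakGradOn hUo
  set G := weakGrad U u
  have hA := ha.memLp_comp hUo hU hG.2
  have key := hu.integral_inner_eq hUo hG
  have iG := integrable_norm_sq hG.2
  have iA := integrable_inner_of_memLp hA hG.2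
  have pt : ∀ x ∈ U, CM / 2 * ‖G x‖ ^ 2 - C0 ^ 2 / (2 * CM) ≤ ⟪a x (G x), G x⟫ := fun x hx => by
    have h1 := ha.mono x (G x) 0
    rw [sub_zero, inner_sub_left] at h1
    have h2 : -(C0 * ‖G x‖) ≤ ⟪a x 0, G x⟫ := by
      have := (abs_le.1 (abs_real_inner_le_norm (a x 0) (G x))).1
      have := mul_le_mul_of_nonneg_right (hC x hx) (norm_nonneg (G x))
      linarith
    have h3 : C0 * ‖G x‖ ≤ CM / 2 * ‖G x‖ ^ 2 + C0 ^ 2 / (2 * CM) := by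
      have h4 : CM / 2 * ‖G x‖ ^ 2 + C0 ^ 2 / (2 * CM) - C0 * ‖G x‖
          = (CM * ‖G x‖ - C0) ^ 2 / (2 * CM) := by
        field_simp
        ring
      have : 0 ≤ (CM * ‖G x‖ - C0) ^ 2 / (2 * CM) := by positivity
      linarith
    linarith
  have h1 : CM / 2 * (∫ x in U, ‖G x‖ ^ 2) - C0 ^ 2 / (2 * CM) * m
      ≤ ∫ x in U, ⟪a x (G x), G x⟫ := by
    have := setIntegral_mono_on (μ := volume) ((iG.const_mul (CM / 2)).sub
      (integrable_const (C0 ^ 2 / (2 * CM)))) iA hUo.measurableSet pt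
    simp only [Pi.sub_apply] at this
    rw [integral_sub (iG.const_mul _) (integrable_const _), integral_const_mul] at this
    simpa [m, mul_comm, Measure.real] using this
  have h2 : ∫ x in U, f x * u x ≤ (∫ x in U, f x ^ 2) / 2 + (∫ x in U, u x ^ 2) / 2 := by
    rw [← integral_div, ← integral_div, ← integral_add (hf.integrable_sq.div_const _)
      (hu.1.1.integrable_sq.div_const _)]
    refine integral_mono (hf.integrable_mul hu.1.1)
      ((hf.integrable_sq.div_const _).add (hu.1.1.integrable_sq.div_const _)) fun x => ?_
    change f x * u x ≤ f x ^ 2 / 2 + u x ^ 2 / 2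
    nlinarith [sq_nonneg (f x - u x)]
  have hF : 0 ≤ ∫ x in U, f x ^ 2 := integral_nonneg fun x => sq_nonneg _
  have hu0 : 0 ≤ ∫ x in U, u x ^ 2 := integral_nonneg fun x => sq_nonneg _
  rw [div_mul_eq_mul_div, le_div_iff₀ hCM]
  have h5 : C0 ^ 2 * m / CM = 2 * (C0 ^ 2 / (2 * CM) * m) := by
    field_simp
  have h6 : 0 ≤ C0 ^ 2 * m / CM := by positivity
  nlinarith [mul_nonneg h6 (add_nonneg hF hu0)]

end StructureConditions

/-! ### Cutoff functions -/

theorem IsTest.gradient_eq_zero {U : Set (E n)} {φ : E n → ℝ} (h : IsTest U φ) {x : E n}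
    (hx : x ∉ U) : gradient φ x = 0 := by
  simp [gradient, h.fderiv_eq_zero hx]

theorem norm_gradient (φ : E n → ℝ) (x : E n) : ‖gradient φ x‖ = ‖fderiv ℝ φ x‖ := by
  simp [gradient]

theorem gradient_mul_self {φ : E n → ℝ} {x : E n} (h : DifferentiableAt ℝ φ x) :
    gradient (fun x => φ x * φ x) x = (2 * φ x) • gradient φ x := by
  simp only [gradient]
  rw [fderiv_fun_mul h h, map_add, LinearIsometryEquiv.map_smulₛₗ]
  simp [two_mul, add_smul]

theorem exists_isTest_eq_one {U K : Set (E n)} (hU : IsOpen U) (hK : IsCompact K) (hKU : K ⊆ U) :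
    ∃ ζ, IsTest U ζ ∧ (∀ x, 0 ≤ ζ x ∧ ζ x ≤ 1) ∧ ∀ x ∈ K, ∀ᶠ y in nhds x, ζ y = 1 := by
  obtain ⟨L, hL, hKL, hLU⟩ := exists_compact_between hK hU hKU
  obtain ⟨ζ, h1, h0, hb⟩ := exists_contMDiffMap_one_nhds_of_subset_interior (n := ⊤)
    (modelWithCornersSelf ℝ (E n)) hK.isClosed hKL
  have hs : tsupport ζ ⊆ L := closure_minimal (fun x hx => by
    by_contra hxL
    exact hx (h0 x hxL)) hL.isClosed
  exact ⟨ζ, ⟨ζ.contMDiff.contDiff, hL.of_isClosed_subset (isClosed_tsupport _) hs, hs.trans hLU⟩,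
    fun x => hb x, fun x hx => h1.filter_mono (nhds_le_nhdsSet hx)⟩

/-- A pair of nested cutoff functions: `ζ` is one on the compact set `K`, and `η` is one near all
translates of the support of `ζ` by vectors of length at most `r`. -/
theorem exists_cutoffs {U K : Set (E n)} (hU : IsOpen U) (hK : IsCompact K) (hKU : K ⊆ U) :
    ∃ (ζ η : E n → ℝ) (r : ℝ), 0 < r ∧ IsTest U ζ ∧ IsTest U η ∧ (∀ x, 0 ≤ ζ x ∧ ζ x ≤ 1) ∧
      (∀ x, 0 ≤ η x ∧ η x ≤ 1) ∧ (∀ x ∈ K, ζ x = 1) ∧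
      ∀ x ∈ tsupport ζ, ∀ h : E n, ‖h‖ ≤ r → ∀ᶠ y in nhds (x + h), η y = 1 := by
  obtain ⟨ζ, hζ, hζb, hζ1⟩ := exists_isTest_eq_one hU hK hKU
  have hc : IsCompact (tsupport ζ) := hζ.2
  obtain ⟨r, hr, hrU⟩ := hc.exists_cthickening_subset_open hU hζ.3
  obtain ⟨η, hη, hηb, hη1⟩ := exists_isTest_eq_one hU (hc.cthickening (r := r)) hrU
  refine ⟨ζ, η, r, hr, hζ, hη, hζb, hηb, fun x hx => (hζ1 x hx).self_of_nhds,
    fun x hx h hh => hη1 _ ?_⟩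
  exact Metric.mem_cthickening_of_dist_le (x + h) x r _ hx (by simpa [dist_eq_norm] using hh)

/-! ### The localized energy estimate for differences -/

section Pointwise

variable {F : Type*} [NormedAddCommGroup F] [InnerProductSpace ℝ F]

/-- The pointwise inequality behind the energy estimate: `P` and `Q` are the differences of the
flux and of the gradient, `b` bounds the part of `P` due to the dependence of the coefficients on
the position, and the second argument on the right is the gradient of `ζ²` times a difference `d`.
The mixed terms are absorbed by Young's inequality. -/
theorem flux_difference_lower_bound {CL CM b ζ d : ℝ} {P Q Z : F} (hCM : 0 < CM)
    (hζ : 0 ≤ ζ) (h1 : CM * ‖Q‖ ^ 2 - b * ‖Q‖ ≤ ⟪P, Q⟫) (h2 : ‖P‖ ≤ CL * ‖Q‖ + b) :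
    CM / 2 * ‖ζ • Q‖ ^ 2 - (1 + 1 / CM + 4 * CL ^ 2 / CM) * ((ζ * b) ^ 2 + ‖d • Z‖ ^ 2)
      ≤ ⟪P, (ζ * ζ) • Q + d • (2 * ζ) • Z⟫ := by
  have e1 : ⟪P, (ζ * ζ) • Q + d • (2 * ζ) • Z⟫ = ζ ^ 2 * ⟪P, Q⟫ + 2 * ζ * ⟪P, d • Z⟫ := by
    simp only [inner_add_right, real_inner_smul_right]
    ring
  have h3 : -(‖P‖ * ‖d • Z‖) ≤ ⟪P, d • Z⟫ := (abs_le.1 (abs_real_inner_le_norm P (d • Z))).1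
  have hD0 : 0 ≤ ‖d • Z‖ := norm_nonneg _
  rw [e1, norm_smul ζ Q, Real.norm_eq_abs, abs_of_nonneg hζ]
  set D := ‖d • Z‖
  have h4 : -((CL * ‖Q‖ + b) * D) ≤ ⟪P, d • Z⟫ := by
    have := mul_le_mul_of_nonneg_right h2 hD0
    linarith
  have h5 := mul_le_mul_of_nonneg_left h1 (sq_nonneg ζ)
  have h6 := mul_le_mul_of_nonneg_left h4 (mul_nonneg zero_le_two hζ)
  set q := ζ * ‖Q‖ with hq
  have y1 : (ζ * b) * q ≤ CM / 4 * q ^ 2 + 1 / CM * (ζ * b) ^ 2 := by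
    have : CM / 4 * q ^ 2 + 1 / CM * (ζ * b) ^ 2 - (ζ * b) * q
        = (CM * q - 2 * (ζ * b)) ^ 2 / (4 * CM) := by
      field_simp
      ring
    have : 0 ≤ (CM * q - 2 * (ζ * b)) ^ 2 / (4 * CM) := by positivity
    linarith
  have y2 : 2 * CL * D * q ≤ CM / 4 * q ^ 2 + 4 * CL ^ 2 / CM * D ^ 2 := by
    have : CM / 4 * q ^ 2 + 4 * CL ^ 2 / CM * D ^ 2 - 2 * CL * D * q
        = (CM * q - 4 * CL * D) ^ 2 / (4 * CM) := by
      field_simp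
      ring
    have : 0 ≤ (CM * q - 4 * CL * D) ^ 2 / (4 * CM) := by positivity
    linarith
  have y3 : 2 * D * (ζ * b) ≤ D ^ 2 + (ζ * b) ^ 2 := by nlinarith [sq_nonneg (D - ζ * b)]
  have p1 : 0 ≤ 1 / CM * D ^ 2 := by positivity
  have p2 : 0 ≤ 4 * CL ^ 2 / CM * (ζ * b) ^ 2 := by positivity
  have l1 : ζ ^ 2 * (CM * ‖Q‖ ^ 2 - b * ‖Q‖) = CM * q ^ 2 - (ζ * b) * q := by
    rw [hq]
    ring
  have l2 : 2 * ζ * -((CL * ‖Q‖ + b) * D) = -(2 * CL * D * q) - 2 * D * (ζ * b) := by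
    rw [hq]
    ring
  rw [l1] at h5
  rw [l2] at h6
  linarith

theorem norm_sq_cutoff_gradient_le {ζ d : ℝ} {Q Z : F} (hζ : 0 ≤ ζ) (hζ1 : ζ ≤ 1) :
    ‖(ζ * ζ) • Q + d • (2 * ζ) • Z‖ ^ 2 ≤ 2 * ‖ζ • Q‖ ^ 2 + 8 * ‖d • Z‖ ^ 2 := by
  have e : (ζ * ζ) • Q + d • (2 * ζ) • Z = ζ • (ζ • Q + (2 : ℝ) • d • Z) := by
    module
  have h1 : ‖ζ • (ζ • Q + (2 : ℝ) • d • Z)‖ ≤ ‖ζ • Q + (2 : ℝ) • d • Z‖ := by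
    rw [norm_smul, Real.norm_eq_abs, abs_of_nonneg hζ]
    exact mul_le_of_le_one_left (norm_nonneg _) hζ1
  have h2 := norm_add_le (ζ • Q) ((2 : ℝ) • d • Z)
  rw [norm_smul (2 : ℝ)] at h2
  norm_num at h2
  rw [e]
  calc _ ≤ (‖ζ • Q‖ + 2 * ‖d • Z‖) ^ 2 := pow_le_pow_left₀ (norm_nonneg _) (h1.trans h2) 2
    _ ≤ _ := by nlinarith [sq_nonneg (‖ζ • Q‖ - 2 * ‖d • Z‖)]

end Pointwise

/-- Summation by parts for differences. -/
theorem integral_inner_translate_sub {A Φ : E n → E n} (hA : MemLp A 2 volume)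
    (hΦ : MemLp Φ 2 volume) (h : E n) :
    ∫ x, ⟪A x, Φ (x - h) - Φ x⟫ = ∫ x, ⟪A (x + h) - A x, Φ x⟫ := by
  have hAh : MemLp (fun x => A (x + h)) 2 volume :=
    hA.comp_measurePreserving (measurePreserving_add_right volume h)
  have hΦh : MemLp (fun x => Φ (x - h)) 2 volume :=
    hΦ.comp_measurePreserving (measurePreserving_sub_right volume h)
  simp only [inner_sub_left, inner_sub_right]
  rw [integral_sub (integrable_inner_of_memLp hA hΦh) (integrable_inner_of_memLp hA hΦ),
    integral_sub (integrable_inner_of_memLp hAh hΦ) (integrable_inner_of_memLp hA hΦ),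
    ← integral_add_right_eq_self (fun x => ⟪A x, Φ (x - h)⟫) h]
  simp

namespace StructureConditions

variable {a : E n → E n → E n} {CL CM CQ : ℝ}

/-- Monotonicity and growth of the flux difference between two points: the position is changed
first, at the fixed gradient `p`, which costs the terms with `CQ`. -/
theorem flux_difference_bounds (ha : StructureConditions a CL CM CQ) (x y p q : E n) :
    CM * ‖q - p‖ ^ 2 - CQ * (‖p‖ + 1) * ‖y - x‖ * ‖q - p‖ ≤ ⟪a y q - a x p, q - p⟫ ∧
      ‖a y q - a x p‖ ≤ CL * ‖q - p‖ + CQ * (‖p‖ + 1) * ‖y - x‖ := by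
  have e : a y q - a x p = (a y q - a y p) + (a y p - a x p) := by abel
  rw [e]
  constructor
  · rw [inner_add_left]
    have h1 := ha.mono y q p
    have h2 := (abs_le.1 (abs_real_inner_le_norm (a y p - a x p) (q - p))).1
    have h3 := mul_le_mul_of_nonneg_right (ha.qlip y x p) (norm_nonneg (q - p))
    linarith
  · exact (norm_add_le _ _).trans (add_le_add (ha.lip y q p) (ha.qlip y x p))

/-- The energy estimate for differences. The equation is tested with `ψ(· - h) - ψ`, where
`ψ = ζ² (w(· + h) - w)` and `w = η u` has the weak gradient `W`. By `h0` and `hh`, `η` is one near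
the support of `ζ` and near its translate by `h`. -/
theorem integral_cutoff_difference_sq_le (ha : StructureConditions a CL CM CQ) {U : Set (E n)}
    (hUo : IsOpen U) (hU : Bornology.IsBounded U) {f u : E n → ℝ} (hf : MemL2 U f)
    (hu : IsWeakSolution U a f u) {ζ η : E n → ℝ} (hζ : IsTest U ζ) (hη : IsTest U η)
    (hζb : ∀ x, 0 ≤ ζ x ∧ ζ x ≤ 1) {h : E n}
    (h0 : ∀ x ∈ tsupport ζ, ∀ᶠ y in nhds x, η y = 1)
    (hh : ∀ x ∈ tsupport ζ, ∀ᶠ y in nhds (x + h), η y = 1)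
    {w : E n → ℝ} (hw : w = fun x => η x * u x) {W : E n → E n}
    (hW : W = fun x => η x • weakGrad U u x + u x • gradient η x)
    {S K : ℝ} (hS : ∀ x, ‖gradient ζ x‖ ≤ S) (hK : K = 1 + 1 / CM + 4 * CL ^ 2 / CM) :
    CM / 4 * ∫ x, ‖ζ x • (W (x + h) - W x)‖ ^ 2 ≤
      ‖h‖ ^ 2 * (K * CQ ^ 2 * (2 * (∫ x in U, ‖weakGrad U u x‖ ^ 2) + 2 * volume.real U)
        + (K + CM) * S ^ 2 * (∫ x, ‖W x‖ ^ 2) + 2 / CM * ∫ x in U, f x ^ 2) := by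
  have : IsFiniteMeasure (volume.restrict U) :=
    isFiniteMeasure_restrict.2 hU.measure_lt_top.ne
  have hCM := ha.CM_pos
  have hK0 : 0 ≤ K := by rw [hK]; positivity
  have hG := hu.1.hasWeakGradOn hUo
  have hsol := fun v Φ => hu.integral_inner_eq (v := v) (Φ := Φ) hUo
  set G := weakGrad U u
  have hwW : HasWeakGradOn univ w W := by
    rw [hw, hW]
    exact hG.cutoff_mul hUo hη
  -- near the support of `ζ` and its translate, `W` is the gradient of `u`
  have hWG : ∀ y, (∀ᶠ z in nhds y, η z = 1) → y ∈ U ∧ W y = G y := by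
    intro y hy
    have hy1 := hy.self_of_nhds
    refine ⟨?_, ?_⟩
    · by_contra hyU
      rw [hη.eq_zero hyU] at hy1
      exact zero_ne_one hy1
    · have : gradient η y = 0 := by
        have : η =ᶠ[nhds y] fun _ => (1 : ℝ) := hy
        simp [gradient, this.fderiv_eq]
      simp [hW, hy1, this]
  have hδ := (hwW.comp_add h).sub hwW
  set δw : E n → ℝ := fun x => w (x + h) - w x
  set δW : E n → E n := fun x => W (x + h) - W x
  have hζ2 : IsTest univ fun x => ζ x * ζ x := (hζ.mul_left hζ.1).mono (subset_univ _)
  have hψ := hδ.cutoff_mul isOpen_univ hζ2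
  simp only [gradient_mul_self hζ.differentiable.differentiableAt] at hψ
  set ψ : E n → ℝ := fun x => (ζ x * ζ x) * δw x
  set Φ : E n → E n := fun x => (ζ x * ζ x) • δW x + δw x • (2 * ζ x) • gradient ζ x
  have hv := (hψ.comp_add (-h)).sub hψ
  have hΦm := hψ.memLp_grad_univ
  have hΦle : ∀ x, ‖Φ x‖ ^ 2 ≤ 2 * ‖ζ x • δW x‖ ^ 2 + 8 * ‖δw x • gradient ζ x‖ ^ 2 := fun x =>
    norm_sq_cutoff_gradient_le (hζb x).1 (hζb x).2
  -- square integrability of the two parts of `Φ`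
  have hgc : Continuous (gradient ζ) :=
    (InnerProductSpace.toDual ℝ (E n)).symm.continuous.comp hζ.continuous_fderiv
  have hXm : MemLp (fun x => ζ x • δW x) 2 volume :=
    hδ.memLp_grad_univ.of_le (hζ.continuous.aestronglyMeasurable.smul hδ.memLp_grad_univ.1)
      (.of_forall fun x => by
        rw [norm_smul, Real.norm_eq_abs, abs_of_nonneg (hζb x).1]
        exact mul_le_of_le_one_left (norm_nonneg _) (hζb x).2)
  have hYle : ∀ x, ‖δw x • gradient ζ x‖ ≤ S * ‖δw x‖ := fun x => by
    rw [norm_smul, mul_comm]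
    exact mul_le_mul_of_nonneg_right (hS x) (norm_nonneg _)
  have hYm : MemLp (fun x => δw x • gradient ζ x) 2 volume :=
    hδ.memLp_univ.of_le_mul (hδ.memLp_univ.1.smul hgc.aestronglyMeasurable) (.of_forall hYle)
  have iX := integrable_norm_sq hXm
  have iY := integrable_norm_sq hYm
  set X := ∫ x, ‖ζ x • δW x‖ ^ 2
  set Y := ∫ x, ‖δw x • gradient ζ x‖ ^ 2
  have hWh : ∀ (T : E n → E n), MemLp T 2 volume → ∀ h : E n,
      (eLpNorm (fun x => ⟪T x, h⟫) 2 volume).toReal ^ 2 ≤ ‖h‖ ^ 2 * ∫ x, ‖T x‖ ^ 2 := by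
    intro T hT h
    rw [← integral_sq_eq (hT.inner_const h), ← integral_const_mul]
    refine integral_mono (hT.inner_const h).integrable_sq ((integrable_norm_sq hT).const_mul _)
      fun x => ?_
    have := abs_real_inner_le_norm (T x) h
    calc ⟪T x, h⟫ ^ 2 = |⟪T x, h⟫| ^ 2 := (sq_abs _).symm
      _ ≤ (‖T x‖ * ‖h‖) ^ 2 := pow_le_pow_left₀ (abs_nonneg _) this 2
      _ = _ := by ring
  -- the first differences of `w` are controlled by its gradient
  have hY : Y ≤ S ^ 2 * (‖h‖ ^ 2 * ∫ x, ‖W x‖ ^ 2) := by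
    have h1 : Y ≤ S ^ 2 * ∫ x, δw x ^ 2 := by
      rw [← integral_const_mul]
      refine integral_mono iY (hδ.memLp_univ.integrable_sq.const_mul _) fun x => ?_
      calc ‖δw x • gradient ζ x‖ ^ 2 ≤ (S * ‖δw x‖) ^ 2 :=
            pow_le_pow_left₀ (norm_nonneg _) (hYle x) 2
        _ = _ := by simp [mul_pow]
    have h2 : ∫ x, δw x ^ 2 ≤ ‖h‖ ^ 2 * ∫ x, ‖W x‖ ^ 2 := by
      rw [integral_sq_eq hδ.memLp_univ]
      exact (pow_le_pow_left₀ ENNReal.toReal_nonneg (hwW.eLpNorm_translate_sub_le h) 2).trans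
        (hWh W hwW.memLp_grad_univ h)
    exact h1.trans (mul_le_mul_of_nonneg_left h2 (sq_nonneg S))
  -- Young's inequality with the weight `CM / 8`, so that half of the coercive term `CM / 2 * X` is left
  have hR : |∫ x in U, f x * (ψ (x + -h) - ψ x)| ≤
      CM / 4 * X + CM * Y + ‖h‖ ^ 2 * (2 / CM * ∫ x in U, f x ^ 2) := by
    have hvm := hv.memLp_univ
    have h1 := abs_integral_mul_le hf (hvm.restrict U)
    have h2 : (eLpNorm (fun x => ψ (x + -h) - ψ x) 2 (volume.restrict U)).toReal
        ≤ (eLpNorm (fun x => ⟪Φ x, -h⟫) 2 volume).toReal :=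
      (ENNReal.toReal_mono hvm.2.ne (eLpNorm_mono_measure _ Measure.restrict_le_self)).trans
        (hψ.eLpNorm_translate_sub_le (-h))
    have h3 := hWh Φ hΦm (-h)
    have h4 : ∫ x, ‖Φ x‖ ^ 2 ≤ 2 * X + 8 * Y := by
      rw [← integral_const_mul, ← integral_const_mul,
        ← integral_add (iX.const_mul 2) (iY.const_mul 8)]
      exact integral_mono (integrable_norm_sq hΦm) ((iX.const_mul 2).add (iY.const_mul 8)) hΦle
    rw [integral_sq_eq hf]
    have e1 : 0 ≤ (eLpNorm f 2 (volume.restrict U)).toReal := ENNReal.toReal_nonneg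
    have e2 : 0 ≤ (eLpNorm (fun x => ⟪Φ x, -h⟫) 2 volume).toReal := ENNReal.toReal_nonneg
    rw [norm_neg] at h3
    set N := (eLpNorm f 2 (volume.restrict U)).toReal
    set q := (eLpNorm (fun x => ⟪Φ x, -h⟫) 2 volume).toReal
    have h5 := mul_le_mul_of_nonneg_left h2 e1
    have h6 : q ≤ ‖h‖ * √(∫ x, ‖Φ x‖ ^ 2) := by
      refine le_of_sq_le_sq ?_ (by positivity)
      rwa [mul_pow, Real.sq_sqrt (integral_nonneg fun x => by positivity)]
    have h7 := mul_le_mul_of_nonneg_left h6 e1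
    have h8 : (√(∫ x, ‖Φ x‖ ^ 2)) ^ 2 ≤ 2 * X + 8 * Y := by
      rwa [Real.sq_sqrt (integral_nonneg fun x => by positivity)]
    set s := √(∫ x, ‖Φ x‖ ^ 2)
    have h9 : N * (‖h‖ * s) ≤ CM / 8 * s ^ 2 + ‖h‖ ^ 2 * (2 / CM * N ^ 2) := by
      have : CM / 8 * s ^ 2 + ‖h‖ ^ 2 * (2 / CM * N ^ 2) - N * (‖h‖ * s)
          = (CM * s - 4 * ‖h‖ * N) ^ 2 / (8 * CM) := by
        field_simp
        ring
      have : 0 ≤ (CM * s - 4 * ‖h‖ * N) ^ 2 / (8 * CM) := by positivity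
      linarith
    have h10 := mul_le_mul_of_nonneg_left h8 (show 0 ≤ CM / 8 by positivity)
    linarith
  -- the flux is extended by zero, which does not matter since `Φ` vanishes off the support of `ζ`
  have hA := ha.memLp_comp hUo hU hG.2
  set A : E n → E n := U.indicator fun x => a x (G x)
  have hAm : MemLp A 2 volume := (memLp_indicator_iff_restrict hUo.measurableSet).2 hA
  have hid : ∫ x, ⟪A (x + h) - A x, Φ x⟫ = ∫ x in U, f x * (ψ (x + -h) - ψ x) := by
    rw [← hsol _ _ (hv.mono (subset_univ U)), ← integral_inner_translate_sub hAm hΦm,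
      ← integral_indicator hUo.measurableSet]
    congr 1
    ext x
    by_cases hx : x ∈ U
    · simp [A, hx, sub_eq_add_neg]
    · simp [A, hx]
  -- `g` dominates `(‖G‖ + 1) ^ 2`, the growth of the flux in the position
  set g : E n → ℝ := U.indicator fun x => 2 * ‖G x‖ ^ 2 + 2
  have ig0 : IntegrableOn (fun x => 2 * ‖G x‖ ^ 2 + 2) U :=
    ((integrable_norm_sq hG.2).const_mul 2).add (integrable_const 2)
  have ig : Integrable g := (integrable_indicator_iff hUo.measurableSet).2 ig0
  have hg : ∫ x, g x = 2 * (∫ x in U, ‖G x‖ ^ 2) + 2 * volume.real U := by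
    rw [integral_indicator hUo.measurableSet,
      integral_add ((integrable_norm_sq hG.2).const_mul 2) (integrable_const 2),
      integral_const_mul]
    simp [mul_comm]
  have hg0 : ∀ x, 0 ≤ g x := fun x => indicator_nonneg (fun _ _ => by positivity) x
  have pt : ∀ x, CM / 2 * ‖ζ x • δW x‖ ^ 2
      - K * (CQ ^ 2 * ‖h‖ ^ 2 * g x + ‖δw x • gradient ζ x‖ ^ 2) ≤ ⟪A (x + h) - A x, Φ x⟫ := by
    intro x
    by_cases hx : x ∈ tsupport ζ
    · obtain ⟨hxU, hxW⟩ := hWG x (h0 x hx)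
      obtain ⟨hyU, hyW⟩ := hWG (x + h) (hh x hx)
      obtain ⟨b1, b2⟩ := ha.flux_difference_bounds x (x + h) (G x) (G (x + h))
      have eA : A (x + h) - A x = a (x + h) (G (x + h)) - a x (G x) := by
        simp [A, hxU, hyU]
      have eW : δW x = G (x + h) - G x := by simp only [δW, hxW, hyW]
      rw [add_sub_cancel_left, ← eA, ← eW] at b1 b2
      have key := flux_difference_lower_bound (d := δw x) (Z := gradient ζ x) hCM (hζb x).1 b1 b2
      rw [← hK] at key
      have h1 : (ζ x * (CQ * (‖G x‖ + 1) * ‖h‖)) ^ 2 ≤ CQ ^ 2 * ‖h‖ ^ 2 * g x := by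
        have h2 : ζ x ^ 2 ≤ 1 := pow_le_one₀ (hζb x).1 (hζb x).2
        have h3 : (‖G x‖ + 1) ^ 2 ≤ g x := by
          simp only [g, indicator_of_mem hxU]
          nlinarith [sq_nonneg (‖G x‖ - 1)]
        calc (ζ x * (CQ * (‖G x‖ + 1) * ‖h‖)) ^ 2
            = ζ x ^ 2 * (CQ ^ 2 * ‖h‖ ^ 2 * (‖G x‖ + 1) ^ 2) := by ring
          _ ≤ 1 * (CQ ^ 2 * ‖h‖ ^ 2 * g x) := by gcongr
          _ = _ := one_mul _
      have h4 := mul_le_mul_of_nonneg_left (add_le_add_left h1 (‖δw x • gradient ζ x‖ ^ 2)) hK0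
      linarith
    · have z1 : ζ x = 0 := image_eq_zero_of_notMem_tsupport hx
      have z2 : gradient ζ x = 0 :=
        IsTest.gradient_eq_zero ⟨hζ.1, hζ.2, subset_rfl⟩ hx
      have : 0 ≤ K * (CQ ^ 2 * ‖h‖ ^ 2 * g x) := mul_nonneg hK0 (mul_nonneg (by positivity) (hg0 x))
      simpa [z1, z2, Φ] using this
  have hAh : MemLp (fun x => A (x + h) - A x) 2 volume :=
    (hAm.comp_measurePreserving (measurePreserving_add_right volume h)).sub hAm
  have hL : CM / 2 * X - K * (CQ ^ 2 * ‖h‖ ^ 2 * (∫ x, g x) + Y)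
      ≤ ∫ x, ⟪A (x + h) - A x, Φ x⟫ := by
    have i1 := iX.const_mul (CM / 2)
    have i2 := ((ig.const_mul (CQ ^ 2 * ‖h‖ ^ 2)).add iY).const_mul K
    have := integral_mono (i1.sub i2) (integrable_inner_of_memLp hAh hΦm) pt
    refine le_trans (le_of_eq ?_) this
    simp only [Pi.sub_apply]
    rw [integral_sub i1 i2, integral_const_mul, integral_const_mul]
    simp only [Pi.add_apply]
    rw [integral_add (ig.const_mul _) iY, integral_const_mul]
  rw [hid, hg] at hL
  have h1 := (le_abs_self _).trans hR
  have h2 := mul_le_mul_of_nonneg_left hY (add_nonneg hK0 hCM.le)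
  linarith

end StructureConditions

/-! ### Interior second derivatives -/

section Regularity

variable {a : E n → E n → E n} {CL CM CQ : ℝ} {U V : Set (E n)}

/-- On `V`, the differences of the gradient are of first order in `L²`, uniformly in the solution;
the field `W` extends the gradient from `V` to the whole space. -/
theorem StructureConditions.exists_gradient_difference_bound
    (ha : StructureConditions a CL CM CQ) (hUo : IsOpen U) (hU : Bornology.IsBounded U)
    (hV : OpenCompactlyContained V U) :
    ∃ C r : ℝ, 0 ≤ C ∧ 0 < r ∧ ∀ f u, MemL2 U f → IsWeakSolution U a f u →
      ∃ W : E n → E n, MemLp W 2 volume ∧ (∀ x ∈ V, W x = weakGrad U u x) ∧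
        ∀ h : E n, ‖h‖ ≤ r → ∫ x in V, ‖W (x + h) - W x‖ ^ 2 ≤
          C * ‖h‖ ^ 2 * ((∫ x in U, f x ^ 2) + (∫ x in U, u x ^ 2) + 1) := by
  obtain ⟨ζ, η, r, hr, hζ, hη, hζb, hηb, hζ1, hη1⟩ := exists_cutoffs hUo hV.2.1 hV.2.2
  have hζV : ∀ x ∈ V, ζ x = 1 := fun x hx => hζ1 x (subset_closure hx)
  obtain ⟨S, -, hS⟩ := hζ.exists_bound_fderiv
  obtain ⟨S', -, hS'⟩ := hη.exists_bound_fderiv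
  obtain ⟨C0, hC0, hgrad⟩ := ha.exists_integral_grad_sq_le hUo hU
  have hCM := ha.CM_pos
  set K := 1 + 1 / CM + 4 * CL ^ 2 / CM with hK
  have hK0 : 0 ≤ K := by positivity
  set m : ℝ := volume.real U
  have hm : 0 ≤ m := measureReal_nonneg
  refine ⟨4 / CM * (K * CQ ^ 2 * (2 * C0 + 2 * m) + (K + CM) * S ^ 2 * (2 * C0 + 2 * S' ^ 2)
    + 2 / CM), r, by positivity, hr, fun f u hf hu => ?_⟩
  have hG := hu.1.hasWeakGradOn hUo
  have hgr := hgrad f u hf hu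
  set W : E n → E n := fun x => η x • weakGrad U u x + u x • gradient η x with hW
  have hwW := hG.cutoff_mul hUo hη
  have hη0 : ∀ x ∈ tsupport ζ, ∀ᶠ y in nhds x, η y = 1 := fun x hx => by
    simpa using hη1 x hx 0 (by simpa using hr.le)
  refine ⟨W, hwW.memLp_grad_univ, fun x hx => ?_, fun h hh => ?_⟩
  · have hxs : x ∈ tsupport ζ := subset_tsupport ζ (by simp [hζV x hx])
    have h1 := hη0 x hxs
    have h2 : gradient η x = 0 := by
      have : η =ᶠ[nhds x] fun _ => (1 : ℝ) := h1
      simp [gradient, this.fderiv_eq]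
    simp [hW, h2, h1.self_of_nhds]
  have key := ha.integral_cutoff_difference_sq_le hUo hU hf hu hζ hη hζb hη0
    (fun x hx => hη1 x hx h hh) rfl hW (fun x => (norm_gradient ζ x).trans_le (hS x)) hK
  set GG := ∫ x in U, ‖weakGrad U u x‖ ^ 2
  set F := ∫ x in U, f x ^ 2
  set UU := ∫ x in U, u x ^ 2
  have hF0 : 0 ≤ F := integral_nonneg fun x => sq_nonneg _
  have hU0 : 0 ≤ UU := integral_nonneg fun x => sq_nonneg _
  have hWW : ∫ x, ‖W x‖ ^ 2 ≤ 2 * GG + 2 * S' ^ 2 * UU := by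
    have i1 := (integrable_norm_sq hG.2).const_mul 2
    have i2 := hu.1.1.integrable_sq.const_mul (2 * S' ^ 2)
    rw [← setIntegral_eq_integral_of_forall_compl_eq_zero (s := U), ← integral_const_mul,
      ← integral_const_mul, ← integral_add i1 i2]
    · refine integral_mono ((integrable_norm_sq hwW.memLp_grad_univ).restrict) (i1.add i2)
        fun x => ?_
      change ‖η x • weakGrad U u x + u x • gradient η x‖ ^ 2
        ≤ 2 * ‖weakGrad U u x‖ ^ 2 + 2 * S' ^ 2 * u x ^ 2
      have h1 : ‖η x • weakGrad U u x‖ ≤ ‖weakGrad U u x‖ := by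
        rw [norm_smul, Real.norm_eq_abs, abs_of_nonneg (hηb x).1]
        exact mul_le_of_le_one_left (norm_nonneg _) (hηb x).2
      have h2 : ‖u x • gradient η x‖ ≤ |u x| * S' := by
        rw [norm_smul, Real.norm_eq_abs, norm_gradient]
        exact mul_le_mul_of_nonneg_left (hS' x) (abs_nonneg _)
      have h3 := (norm_add_le (η x • weakGrad U u x) (u x • gradient η x)).trans
        (add_le_add h1 h2)
      calc _ ≤ (‖weakGrad U u x‖ + |u x| * S') ^ 2 := pow_le_pow_left₀ (norm_nonneg _) h3 2
        _ ≤ 2 * ‖weakGrad U u x‖ ^ 2 + 2 * (|u x| * S') ^ 2 := by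
          nlinarith [sq_nonneg (‖weakGrad U u x‖ - |u x| * S')]
        _ = _ := by rw [mul_pow, sq_abs]; ring
    · intro x hx
      simp [hW, hη.eq_zero hx, hη.gradient_eq_zero hx]
  have hVX : ∫ x in V, ‖W (x + h) - W x‖ ^ 2 ≤ ∫ x, ‖ζ x • (W (x + h) - W x)‖ ^ 2 := by
    have hWm := hwW.memLp_grad_univ
    have hd : MemLp (fun x => W (x + h) - W x) 2 volume :=
      (hWm.comp_measurePreserving (measurePreserving_add_right volume h)).sub hWm
    have hi : Integrable fun x => ‖ζ x • (W (x + h) - W x)‖ ^ 2 :=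
      integrable_norm_sq (hd.of_le (hζ.continuous.aestronglyMeasurable.smul hd.1)
        (.of_forall fun x => by
          rw [norm_smul, Real.norm_eq_abs, abs_of_nonneg (hζb x).1]
          exact mul_le_of_le_one_left (norm_nonneg _) (hζb x).2))
    calc ∫ x in V, ‖W (x + h) - W x‖ ^ 2 = ∫ x in V, ‖ζ x • (W (x + h) - W x)‖ ^ 2 :=
          setIntegral_congr_fun hV.1.measurableSet fun x hx => by simp [hζV x hx]
      _ ≤ _ := setIntegral_le_integral hi (.of_forall fun x => by positivity)
  refine hVX.trans ?_
  set N := F + UU + 1 with hN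
  have hN1 : 1 ≤ N := by linarith
  have b1 : 2 * GG + 2 * m ≤ (2 * C0 + 2 * m) * N := by nlinarith
  have b2 : ∫ x, ‖W x‖ ^ 2 ≤ (2 * C0 + 2 * S' ^ 2) * N := by
    have : 0 ≤ S' ^ 2 * (F + 1) := by positivity
    nlinarith
  have b3 : 2 / CM * F ≤ 2 / CM * N := by
    gcongr
    linarith
  have key2 : CM / 4 * ∫ x, ‖ζ x • (W (x + h) - W x)‖ ^ 2 ≤
      ‖h‖ ^ 2 * (K * CQ ^ 2 * ((2 * C0 + 2 * m) * N)
        + (K + CM) * S ^ 2 * ((2 * C0 + 2 * S' ^ 2) * N) + 2 / CM * N) :=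
    key.trans (by gcongr)
  have h4 := mul_le_mul_of_nonneg_left key2 (show 0 ≤ 4 / CM by positivity)
  have e1 : ∀ z : ℝ, 4 / CM * (CM / 4 * z) = z := fun z => by
    field_simp
  rw [e1] at h4
  refine h4.trans (le_of_eq ?_)
  ring

/-- The weak second derivatives on `V`, with a bound on their norms which is uniform in the
solution. -/
theorem StructureConditions.exists_second_derivatives
    (ha : StructureConditions a CL CM CQ) (hUo : IsOpen U) (hU : Bornology.IsBounded U)
    (hV : OpenCompactlyContained V U) :
    ∃ C : ℝ, 0 ≤ C ∧ ∀ f u, MemL2 U f → IsWeakSolution U a f u →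
      ∀ i k, ∃ H : E n → ℝ, MemL2 V H ∧ IsWeakPartial V k (weakPartial V i u) H ∧
        l2Norm V H ^ 2 ≤ C * (l2Norm U f ^ 2 + l2Norm U u ^ 2 + 1) := by
  obtain ⟨C, r, hC, hr, hmain⟩ := ha.exists_gradient_difference_bound hUo hU hV
  refine ⟨C, hC, fun f u hf hu i k => ?_⟩
  obtain ⟨W, hWm, hWV, hWb⟩ := hmain f u hf hu
  have hVU : V ⊆ U := subset_closure.trans hV.2.2
  have hG := hu.1.hasWeakGradOn hUo
  rw [integral_sq_eq hf, integral_sq_eq hu.1.1] at hWb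
  change ∀ h : E n, ‖h‖ ≤ r → ∫ x in V, ‖W (x + h) - W x‖ ^ 2 ≤
    C * ‖h‖ ^ 2 * (l2Norm U f ^ 2 + l2Norm U u ^ 2 + 1) at hWb
  set N := l2Norm U f ^ 2 + l2Norm U u ^ 2 + 1
  have hN : 0 ≤ N := by positivity
  have hWi := memLp_coord hWm i
  obtain ⟨H, hH, hHn, hHφ⟩ := exists_weak_deriv_of_translate_le (V := V) hWi
    (EuclideanSpace.single k (1 : ℝ)) (Real.sqrt_nonneg (C * N)) hr (fun t ht => by
      have hn : ‖t • EuclideanSpace.single k (1 : ℝ)‖ = |t| := by simp [norm_smul]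
      have h1 := hWb (t • EuclideanSpace.single k (1 : ℝ)) (by rw [hn]; exact ht.le)
      have hd : MemLp (fun x => W (x + t • EuclideanSpace.single k (1 : ℝ)) - W x) 2 volume :=
        (hWm.comp_measurePreserving (measurePreserving_add_right volume _)).sub hWm
      have hdi : MemLp (fun x => W (x + t • EuclideanSpace.single k (1 : ℝ)) i - W x i) 2 volume :=
        memLp_coord hd i
      refine le_of_sq_le_sq ?_ (by positivity)
      rw [← integral_sq_eq (hdi.restrict V), mul_pow, Real.sq_sqrt (by positivity)]
      rw [hn] at h1
      refine le_trans (integral_mono (hdi.restrict V).integrable_sq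
        (integrable_norm_sq (hd.restrict V)) fun x => ?_) (h1.trans (le_of_eq (by ring)))
      have := PiLp.norm_apply_le (W (x + t • EuclideanSpace.single k (1 : ℝ)) - W x) i
      calc _ = ‖(W (x + t • EuclideanSpace.single k (1 : ℝ)) - W x) i‖ ^ 2 := by simp
        _ ≤ _ := pow_le_pow_left₀ (norm_nonneg _) this 2)
  -- `H` is a weak derivative of a component of `W`, which represents the weak derivative on `V`
  have hae : weakPartial V i u =ᵐ[volume.restrict V] fun x => W x i := by
    refine (((hG.mono hVU).isWeakPartial i).weakPartial_ae_eq hV.1).trans ?_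
    rw [Filter.EventuallyEq, ae_restrict_iff' hV.1.measurableSet]
    exact .of_forall fun x hx => by rw [hWV x hx]
  refine ⟨H, hH, isWeakPartial_of_memLp ((hWi.restrict V).ae_eq hae.symm) hH fun φ hφ => ?_, ?_⟩
  · rw [← hHφ φ hφ]
    apply integral_congr_ae
    filter_upwards [hae] with x hx
    rw [hx]
  · calc l2Norm V H ^ 2 ≤ √(C * N) ^ 2 := pow_le_pow_left₀ ENNReal.toReal_nonneg hHn 2
      _ = C * N := Real.sq_sqrt (by positivity)

theorem l2Norm_congr {u v : E n → ℝ} (h : u =ᵐ[volume.restrict V] v) : l2Norm V u = l2Norm V v := by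
  rw [l2Norm, l2Norm, eLpNorm_congr_ae h]

theorem l2Norm_mono (hVU : V ⊆ U) {u : E n → ℝ} (hu : MemL2 U u) : l2Norm V u ≤ l2Norm U u :=
  ENNReal.toReal_mono hu.2.ne (eLpNorm_mono_measure _ (Measure.restrict_mono hVU le_rfl))

/-- Interior `H²` regularity with the estimate on a fixed compactly contained open set. -/
theorem StructureConditions.exists_h2Norm_le
    (ha : StructureConditions a CL CM CQ) (hUo : IsOpen U) (hU : Bornology.IsBounded U)
    (hV : OpenCompactlyContained V U) :
    ∃ C : ℝ, 0 ≤ C ∧ ∀ f u, MemL2 U f → IsWeakSolution U a f u →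
      MemH2 V u ∧ h2Norm V u ≤ C * (l2Norm U f + l2Norm U u + 1) := by
  obtain ⟨C1, hC1, hgrad⟩ := ha.exists_integral_grad_sq_le hUo hU
  obtain ⟨C2, hC2, hsecond⟩ := ha.exists_second_derivatives hUo hU hV
  refine ⟨√(1 + n * C1 + n * (n * C2)), Real.sqrt_nonneg _, fun f u hf hu => ?_⟩
  have hVU : V ⊆ U := subset_closure.trans hV.2.2
  have hG := hu.1.hasWeakGradOn hUo
  have hGV := hG.mono hVU
  have hsd := hsecond f u hf hu
  have hp : ∀ i, weakPartial V i u =ᵐ[volume.restrict V] fun x => weakGrad U u x i := fun i =>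
    (hGV.isWeakPartial i).weakPartial_ae_eq hV.1
  refine ⟨⟨hGV.memH1, fun i => ⟨(memLp_coord hGV.2 i).ae_eq (hp i).symm, fun k => ?_⟩⟩, ?_⟩
  · obtain ⟨H, hH, hHp, -⟩ := hsd i k
    exact ⟨H, hHp, hH⟩
  have hgr := hgrad f u hf hu
  rw [integral_sq_eq hf, integral_sq_eq hu.1.1] at hgr
  change _ ≤ C1 * (l2Norm U f ^ 2 + l2Norm U u ^ 2 + 1) at hgr
  have hf0 : 0 ≤ l2Norm U f := ENNReal.toReal_nonneg
  have hu0 : 0 ≤ l2Norm U u := ENNReal.toReal_nonneg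
  set N := l2Norm U f ^ 2 + l2Norm U u ^ 2 + 1 with hN
  have b0 : l2Norm V u ^ 2 ≤ N := by
    have : l2Norm V u ^ 2 ≤ l2Norm U u ^ 2 :=
      pow_le_pow_left₀ ENNReal.toReal_nonneg (l2Norm_mono hVU hu.1.1) 2
    have := sq_nonneg (l2Norm U f)
    linarith
  have b1 : ∀ i, l2Norm V (weakPartial V i u) ^ 2 ≤ C1 * N := fun i => by
    refine le_trans ?_ hgr
    rw [l2Norm_congr (hp i)]
    have hi := memLp_coord hG.2 i
    refine (pow_le_pow_left₀ ENNReal.toReal_nonneg (l2Norm_mono hVU hi) 2).trans ?_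
    rw [l2Norm, ← integral_sq_eq hi]
    refine integral_mono hi.integrable_sq (integrable_norm_sq hG.2) fun x => ?_
    calc _ = ‖weakGrad U u x i‖ ^ 2 := by simp
      _ ≤ _ := pow_le_pow_left₀ (norm_nonneg _) (PiLp.norm_apply_le _ i) 2
  have b2 : ∀ i k, l2Norm V (weakPartial V k (weakPartial V i u)) ^ 2 ≤ C2 * N := fun i k => by
    obtain ⟨H, hH, hHp, hHn⟩ := hsd i k
    rwa [l2Norm_congr (hHp.weakPartial_ae_eq hV.1)]
  have s1 : ∑ i, l2Norm V (weakPartial V i u) ^ 2 ≤ n * (C1 * N) := by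
    simpa using Finset.sum_le_card_nsmul Finset.univ _ _ fun i _ => b1 i
  have s2 : ∑ i, ∑ k, l2Norm V (weakPartial V k (weakPartial V i u)) ^ 2
      ≤ n * (n * (C2 * N)) := by
    have h1 : ∀ i : Fin n, ∑ k, l2Norm V (weakPartial V k (weakPartial V i u)) ^ 2
        ≤ n * (C2 * N) := fun i => by
      simpa using Finset.sum_le_card_nsmul Finset.univ _ _ fun k _ => b2 i k
    simpa using Finset.sum_le_card_nsmul Finset.univ _ _ fun i _ => h1 i
  rw [h2Norm]
  refine Real.sqrt_le_iff.2 ⟨by positivity, ?_⟩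
  rw [mul_pow, Real.sq_sqrt (by positivity)]
  have hNle : N ≤ (l2Norm U f + l2Norm U u + 1) ^ 2 := by
    nlinarith [mul_nonneg hf0 hu0]
  calc _ ≤ N + n * (C1 * N) + n * (n * (C2 * N)) := add_le_add (add_le_add b0 s1) s2
    _ = (1 + n * C1 + n * (n * C2)) * N := by ring
    _ ≤ _ := mul_le_mul_of_nonneg_left hNle (by positivity)

end Regularity

end QuasilinearReg

theorem mainTheorem3 (n : ℕ) (U : Set (QuasilinearReg.E n))
    (hU_open : IsOpen U) (hU_bdd : Bornology.IsBounded U)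
    (hU_lip : QuasilinearReg.HasLipschitzBoundary U)
    (a : QuasilinearReg.E n → QuasilinearReg.E n → QuasilinearReg.E n)
    (ha_lip : ∃ CL : ℝ, 0 ≤ CL ∧ ∀ x p q, ‖a x p - a x q‖ ≤ CL * ‖p - q‖)
    (ha_mono : ∃ CM : ℝ, 0 < CM ∧ ∀ x p q, CM * ‖p - q‖ ^ 2 ≤ ⟪a x p - a x q, p - q⟫)
    (ha_qlip : ∃ CQ : ℝ, 0 ≤ CQ ∧ ∀ x y p, ‖a x p - a y p‖ ≤ CQ * (‖p‖ + 1) * ‖x - y‖) :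
    (∀ f u : QuasilinearReg.E n → ℝ, QuasilinearReg.MemL2 U f →
      QuasilinearReg.IsWeakSolution U a f u → QuasilinearReg.MemH2Loc U u) ∧
    (∀ V : Set (QuasilinearReg.E n), QuasilinearReg.OpenCompactlyContained V U →
      ∃ C : ℝ, 0 ≤ C ∧ ∀ f u : QuasilinearReg.E n → ℝ, QuasilinearReg.MemL2 U f →
        QuasilinearReg.IsWeakSolution U a f u →
          QuasilinearReg.h2Norm V u
            ≤ C * (QuasilinearReg.l2Norm U f + QuasilinearReg.l2Norm U u + 1)) := by
  obtain ⟨CL, hCL, hl⟩ := ha_lip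
  obtain ⟨CM, hCM, hm⟩ := ha_mono
  obtain ⟨CQ, hCQ, hq⟩ := ha_qlip
  have ha : QuasilinearReg.StructureConditions a CL CM CQ := ⟨hCL, hCM, hCQ, hl, hm, hq⟩
  refine ⟨fun f u hf hu V hV => ?_, fun V hV => ?_⟩
  · obtain ⟨C, -, h⟩ := ha.exists_h2Norm_le hU_open hU_bdd hV
    exact (h f u hf hu).1
  · obtain ⟨C, hC, h⟩ := ha.exists_h2Norm_le hU_open hU_bdd hV
    exact ⟨C, hC, fun f u hf hu => (h f u hf hu).2⟩
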